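/- Let $k$ be a field of characteristic zero. A graded Hopf algebra over $k$ is a Hopf algebra $H$ with a grading $H=\bigoplus_{n\ge 0}H_n$ that is both an algebra and a coalgebra grading and is preserved by the antipode; it is connected if $H_0=k\cdot 1$. A graded Hopf subalgebra of $H$ is a Hopf subalgebra $K$ (a subalgebra with $\Delta(K)\subseteq K\otimes K$ and $S(K)\subseteq K$) such that $K=\bigoplus_{n\ge 0}(K\cap H_n)$. Theorem B. Let $H$ be a connected graded Hopf algebra over $k$ of finite Gelfand–Kirillov dimension $d$, and let $K$ be a graded Hopf subalgebra of $H$ of Gelfand–Kirillov dimension $e$. Then $d-e$ is a non-negative integer and $H$ is a graded $(d-e)$-step iterated Hopf Ore extension of $K$ of derivation type. That is, with $n=d-e$, there are a chain $$K=H^0\subset H^1\subset\cdots\subset H^{n}=H$$ of graded Hopf subalgebras of $H$ and, for each $i=1,\dots,n$, a homogeneous element $z_i\in H^i$ of some degree $m_i$ and a $k$-linear derivation $\delta_i$ of $H^{i-1}$ which is homogeneous of degree $m_i$ (it maps $H^{i-1}\cap H_j$ into $H^{i-1}\cap H_{j+m_i}$ for all $j\geq 0$), such that $H^i=H^{i-1}[z_i;\delta_i]$: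 one has $z_i r=r z_i+\delta_i(r)$ for all $r\in H^{i-1}$, and $H^i$ is a free left $H^{i-1}$-module with basis $1,z_i,z_i^2,\dots$. -/

import Mathlib

open scoped TensorProduct

/-- The Gelfand-Kirillov dimension of a `k`-algebra `A`: the supremum, over the finite dimensional
subspaces `V` of `A`, of `limsup_n log_n dim (k + V + V² + ⋯ + Vⁿ)`. -/
noncomputable def gkDim (k A : Type*) [Field k] [Ring A] [Algebra k A] : EReal :=
  ⨆ (V : Submodule k A) (_ : FiniteDimensional k V),
    Filter.limsup
      (fun n : ℕ => ((Real.logb (n : ℝ)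
        (Module.finrank k (⨆ i ∈ Finset.range (n + 1), V ^ i : Submodule k A) : ℝ) : ℝ) : EReal))
      Filter.atTop

section GradedHopf

variable {k H : Type*} [Field k] [Ring H] [HopfAlgebra k H]

/-- For subspaces `V`, `W` of `H`, the subspace `V ⊗ W` of `H ⊗ H`. -/
def tensorSubspace (V W : Submodule k H) : Submodule k (H ⊗[k] H) :=
  LinearMap.range (TensorProduct.map V.subtype W.subtype)

/-- The algebra grading `H = ⨁ₙ 𝒜 n` makes `H` a graded Hopf algebra: it is also a
coalgebra grading, and it is preserved by the antipode. -/
structure IsGradedHopfAlgebra (𝒜 : ℕ → Submodule k H) [GradedAlgebra 𝒜] : Prop where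
  comul_mem : ∀ n : ℕ, ∀ x ∈ 𝒜 n,
    Coalgebra.comul (R := k) x ∈
      ⨆ p ∈ Finset.HasAntidiagonal.antidiagonal n, tensorSubspace (𝒜 p.1) (𝒜 p.2)
  counit_eq_zero : ∀ n : ℕ, n ≠ 0 → ∀ x ∈ 𝒜 n, Coalgebra.counit (R := k) x = 0
  antipode_mem : ∀ n : ℕ, ∀ x ∈ 𝒜 n, HopfAlgebra.antipode k x ∈ 𝒜 n

/-- A connected graded Hopf algebra: the degree zero component is `k · 1`. -/
structure IsConnectedGradedHopfAlgebra (𝒜 : ℕ → Submodule k H) [GradedAlgebra 𝒜] : Prop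
    extends IsGradedHopfAlgebra 𝒜 where
  connected : 𝒜 0 = 1

/-- A Hopf subalgebra: a subalgebra that is a subcoalgebra and is stable under the antipode. -/
structure IsHopfSubalgebra (K : Subalgebra k H) : Prop where
  comul_mem : ∀ x ∈ K, Coalgebra.comul (R := k) x ∈
    tensorSubspace (Subalgebra.toSubmodule K) (Subalgebra.toSubmodule K)
  antipode_mem : ∀ x ∈ K, HopfAlgebra.antipode k x ∈ K

/-- A graded Hopf subalgebra: a Hopf subalgebra that contains the homogeneous components of
each of its elements. -/
structure IsGradedHopfSubalgebra (𝒜 : ℕ → Submodule k H) [GradedAlgebra 𝒜]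
    (K : Subalgebra k H) : Prop extends IsHopfSubalgebra K where
  homogeneous : ∀ x ∈ K, ∀ n : ℕ, (DirectSum.decompose 𝒜 x n : H) ∈ K

/-- `S = R[z; σ, δ]` is an Ore extension of `R`: `σ` is an automorphism and `δ` a
`σ`-derivation of `R`, `z r = σ(r) z + δ(r)` for `r` in `R`, and `S` is a free left `R`-module
with basis `1, z, z², …`. -/
structure IsOreExtension (R S : Subalgebra k H) (z : H) (σ : R ≃ₐ[k] R) (δ : R →ₗ[k] R) :
    Prop where
  leibniz : ∀ a b : R, δ (a * b) = σ a * δ b + δ a * b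
  commutation : ∀ r : R, z * (r : H) = (σ r : H) * z + (δ r : H)
  linearIndependent : LinearIndependent R (fun i : ℕ => z ^ i)
  span_eq : (Submodule.span R (Set.range fun i : ℕ => z ^ i) : Set H) = (S : Set H)

/-- A graded Ore extension `S = R[z; σ, δ]`: the variable `z` is homogeneous of some degree `m`,
`σ` preserves degrees and `δ` is homogeneous of degree `m`. -/
structure IsGradedOreExtension (𝒜 : ℕ → Submodule k H) (R S : Subalgebra k H) (z : H) (m : ℕ)
    (σ : R ≃ₐ[k] R) (δ : R →ₗ[k] R) : Prop extends IsOreExtension R S z σ δ where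
  mem_degree : z ∈ 𝒜 m
  map_mem : ∀ j : ℕ, ∀ r : R, (r : H) ∈ 𝒜 j → (σ r : H) ∈ 𝒜 j
  der_mem : ∀ j : ℕ, ∀ r : R, (r : H) ∈ 𝒜 j → (δ r : H) ∈ 𝒜 (j + m)

/-- `S` is a graded Hopf Ore extension of `R` of derivation type, inside the graded Hopf
algebra `H`: both are graded Hopf subalgebras and `S = R[z; id, δ]` as a graded algebra. -/
structure IsGradedHOEOfDerivationType (𝒜 : ℕ → Submodule k H) [GradedAlgebra 𝒜]
    (R S : Subalgebra k H) : Prop where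
  left : IsGradedHopfSubalgebra 𝒜 R
  right : IsGradedHopfSubalgebra 𝒜 S
  le : R ≤ S
  exists_ore : ∃ (z : H) (m : ℕ) (δ : R →ₗ[k] R),
    IsGradedOreExtension 𝒜 R S z m AlgEquiv.refl δ

/-- The graded Hopf algebra `H` is a graded `n`-step iterated Hopf Ore extension of `K` of
derivation type: there is a chain `K = C 0 ⊂ C 1 ⊂ ⋯ ⊂ C n = H` of graded Hopf subalgebras,
each one a graded Hopf Ore extension of derivation type of the previous one. -/
def IsGradedIHOEOfDerivationType (𝒜 : ℕ → Submodule k H) [GradedAlgebra 𝒜]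
    (n : ℕ) (K : Subalgebra k H) : Prop :=
  ∃ C : Fin (n + 1) → Subalgebra k H,
    C 0 = K ∧ C (Fin.last n) = ⊤ ∧
    (∀ i : Fin (n + 1), IsGradedHopfSubalgebra 𝒜 (C i)) ∧
    ∀ i : Fin n, IsGradedHOEOfDerivationType 𝒜 (C i.castSucc) (C i.succ)

end GradedHopf

/-! Let `K ⊆ L` be graded Hopf subalgebras, and call `z` relatively primitive if `Δz - z ⊗ 1 - 1 ⊗
z` lies in `K ⊗ K`. If `K ≠ L`, a homogeneous element of least degree in `L` outside `K` is
relatively primitive (`exists_relPrimitive`). Adjoining any homogeneous relatively primitive `z ∉ K`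
gives a graded Hopf subalgebra `K[z]` in which the powers of `z` are left independent over `K`:
contracting `Δ` with a suitable functional gives a derivation that kills `K` and sends `z` to `1`,
and the characteristic is zero (`exists_derivative`, `linearIndependent_pow`). So each such step
raises the growth by one (`HasGrowth.succ`).

To make `z` normalize `K`, it is chosen of maximal degree among these elements. By induction on the
degree of `r`, the commutator `[z, r]` is again relatively primitive and of higher degree, hence in
`K` (`commutator_mem`). A maximum exists because each degree in which such elements occur
contributes one to the growth of `L`, which finite Gelfand–Kirillov dimension bounds
(`hasGrowth_add_card`). The same bound makes the iteration stop (`exists_chain`).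

Finally, an `n`-step chain starting at `k` has Gelfand–Kirillov dimension exactly `n` (`gkDim_eq`).
Applied to a chain from `k` to `K`, and to its continuation to `H`, this gives `d - e` as the number
of steps from `K` to `H`. -/

open scoped TensorProduct

/-! ### Subspaces and subalgebras of the tensor square. -/

section Tensor

variable {k H : Type*} [Field k] [Ring H] [HopfAlgebra k H]

theorem tensorSubspace_mono {V V' W W' : Submodule k H} (hV : V ≤ V') (hW : W ≤ W') :
    tensorSubspace V W ≤ tensorSubspace V' W' :=
  TensorProduct.range_map_mono (by simpa using hV) (by simpa using hW)

theorem tmul_mem_tensorSubspace {V W : Submodule k H} {a b : H} (ha : a ∈ V) (hb : b ∈ W) :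
    a ⊗ₜ[k] b ∈ tensorSubspace V W :=
  ⟨(⟨a, ha⟩ : V) ⊗ₜ (⟨b, hb⟩ : W), rfl⟩

theorem tensorSubspace_le {V W : Submodule k H} {T : Submodule k (H ⊗[k] H)}
    (h : ∀ a ∈ V, ∀ b ∈ W, a ⊗ₜ[k] b ∈ T) : tensorSubspace V W ≤ T := by
  rintro _ ⟨t, rfl⟩
  induction t with
  | zero => simp
  | add x y hx hy => rw [map_add]; exact T.add_mem hx hy
  | tmul a b => exact h a a.2 b b.2

/-- The image of `K ⊗ K` in `H ⊗ H`, as a subalgebra. -/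
def tensorSubalgebra (K : Subalgebra k H) : Subalgebra k (H ⊗[k] H) :=
  (Algebra.TensorProduct.map K.val K.val).range

theorem mem_tensorSubalgebra {K : Subalgebra k H} {t : H ⊗[k] H} :
    t ∈ tensorSubalgebra K ↔
      t ∈ tensorSubspace (Subalgebra.toSubmodule K) (Subalgebra.toSubmodule K) :=
  Iff.rfl

theorem tmul_mem_tensorSubalgebra {K : Subalgebra k H} {a b : H} (ha : a ∈ K) (hb : b ∈ K) :
    a ⊗ₜ[k] b ∈ tensorSubalgebra K :=
  mem_tensorSubalgebra.2 (tmul_mem_tensorSubspace ha hb)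

theorem tensorSubalgebra_mono {K L : Subalgebra k H} (h : K ≤ L) :
    tensorSubalgebra K ≤ tensorSubalgebra L :=
  fun _ ht => mem_tensorSubalgebra.2 (tensorSubspace_mono h h (mem_tensorSubalgebra.1 ht))

end Tensor

/-! ### Homogeneous subalgebras, the coproduct by degree, and relative primitives. -/

section Graded

variable {k H : Type*} [Field k] [Ring H] [HopfAlgebra k H]
  (𝒜 : ℕ → Submodule k H) [GradedAlgebra 𝒜]

/-- A subalgebra containing the homogeneous components of its elements. -/
def IsHomogeneousSubalgebra (K : Subalgebra k H) : Prop :=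
  ∀ x ∈ K, ∀ n : ℕ, GradedAlgebra.proj 𝒜 n x ∈ K

variable {𝒜}

theorem proj_mem_degree (n : ℕ) (x : H) : GradedAlgebra.proj 𝒜 n x ∈ 𝒜 n :=
  SetLike.coe_mem _

theorem proj_same {n : ℕ} {x : H} (hx : x ∈ 𝒜 n) : GradedAlgebra.proj 𝒜 n x = x :=
  DirectSum.decompose_of_mem_same 𝒜 hx

theorem proj_ne {n m : ℕ} {x : H} (hx : x ∈ 𝒜 n) (h : n ≠ m) : GradedAlgebra.proj 𝒜 m x = 0 :=
  DirectSum.decompose_of_mem_ne 𝒜 hx h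

theorem exists_sum_proj (x : H) : ∃ N : ℕ, ∀ M, N ≤ M →
    ∑ i ∈ Finset.range M, GradedAlgebra.proj 𝒜 i x = x := by
  classical
  refine ⟨(DirectSum.decompose 𝒜 x).support.sup id + 1, fun M hM => ?_⟩
  conv_rhs => rw [← DirectSum.sum_support_decompose 𝒜 x]
  refine (Finset.sum_subset (fun i hi => ?_) fun i _ hi => ?_).symm
  · have : id i ≤ _ := Finset.le_sup (f := id) hi
    simp only [id] at this
    simp only [Finset.mem_range]
    omega
  · simpa using hi

theorem induction_homogeneous {p : H → Prop} (x : H) (hadd : ∀ a b, p a → p b → p (a + b))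
    (h0 : p 0) (hp : ∀ n, p (GradedAlgebra.proj 𝒜 n x)) : p x := by
  obtain ⟨N, hN⟩ := exists_sum_proj (𝒜 := 𝒜) x
  rw [← hN N le_rfl]
  exact Finset.sum_induction _ p hadd h0 fun i _ => hp i

theorem mul_mem_degree {i j : ℕ} {x y : H} (hx : x ∈ 𝒜 i) (hy : y ∈ 𝒜 j) : x * y ∈ 𝒜 (i + j) :=
  SetLike.GradedMul.mul_mem hx hy

theorem pow_mem_degree {m : ℕ} {z : H} (hz : z ∈ 𝒜 m) (n : ℕ) : z ^ n ∈ 𝒜 (n * m) := by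
  simpa using SetLike.pow_mem_graded n hz

theorem isHomogeneousSubalgebra_adjoin {s : Set H} (hs : ∀ x ∈ s, ∃ n, x ∈ 𝒜 n) :
    IsHomogeneousSubalgebra 𝒜 (Algebra.adjoin k s) := by
  intro x hx n
  induction hx using Algebra.adjoin_induction generalizing n with
  | mem x hx =>
    obtain ⟨i, hi⟩ := hs x hx
    by_cases h : i = n
    · subst h; rw [proj_same hi]; exact Algebra.subset_adjoin hx
    · rw [proj_ne hi h]; exact zero_mem _
  | algebraMap r =>
    have h1 : algebraMap k H r ∈ 𝒜 0 := SetLike.algebraMap_mem_graded 𝒜 r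
    by_cases h : 0 = n
    · subst h; rw [proj_same h1]; exact Subalgebra.algebraMap_mem _ _
    · rw [proj_ne h1 h]; exact zero_mem _
  | add x y _ _ hx hy => rw [map_add]; exact add_mem (hx n) (hy n)
  | mul x y _ _ hx hy =>
    refine induction_homogeneous (𝒜 := 𝒜)
      (p := fun w => GradedAlgebra.proj 𝒜 n (w * y) ∈ Algebra.adjoin k s) x
      (fun a b ha hb => ?_) (by simp) fun i => ?_
    · rw [add_mul, map_add]; exact add_mem ha hb
    · rw [GradedAlgebra.proj_apply,
        DirectSum.coe_decompose_mul_of_left_mem 𝒜 n (proj_mem_degree i x)]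
      split_ifs
      · exact mul_mem (hx i) (hy _)
      · exact zero_mem _

/-- Since `K` is spanned by its homogeneous elements, these can replace `K` in the generating set.
-/
theorem IsHomogeneousSubalgebra.adjoin_insert {K : Subalgebra k H}
    (hK : IsHomogeneousSubalgebra 𝒜 K) {z : H} {m : ℕ} (hz : z ∈ 𝒜 m) :
    IsHomogeneousSubalgebra 𝒜 (Algebra.adjoin k (insert z (K : Set H))) := by
  have : Algebra.adjoin k (insert z (K : Set H)) =
      Algebra.adjoin k (insert z {x | x ∈ K ∧ ∃ n, x ∈ 𝒜 n}) := by
    apply le_antisymm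
    · refine Algebra.adjoin_le (Set.insert_subset
        (Algebra.subset_adjoin (Set.mem_insert _ _)) fun x hx => ?_)
      refine induction_homogeneous (𝒜 := 𝒜) x (fun a b => add_mem) (zero_mem _) fun n => ?_
      exact Algebra.subset_adjoin (Or.inr ⟨hK x hx n, n, proj_mem_degree n x⟩)
    · exact Algebra.adjoin_mono (Set.insert_subset_insert fun x hx => hx.1)
  rw [this]
  apply isHomogeneousSubalgebra_adjoin
  rintro x (rfl | hx)
  exacts [⟨m, hz⟩, hx.2]

/-- The component of the coproduct of `x` in `𝒜 i ⊗ 𝒜 j`. -/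
noncomputable def comulComponent (𝒜 : ℕ → Submodule k H) [GradedAlgebra 𝒜] (i j : ℕ) (x : H) :
    H ⊗[k] H :=
  TensorProduct.map (GradedAlgebra.proj 𝒜 i) (GradedAlgebra.proj 𝒜 j)
    (Coalgebra.comul (R := k) x)

theorem comulComponent_mem {K : Subalgebra k H} (hK : IsHomogeneousSubalgebra 𝒜 K) {x : H}
    (hx : Coalgebra.comul (R := k) x ∈ tensorSubalgebra K) (i j : ℕ) :
    comulComponent 𝒜 i j x ∈ tensorSubspace (Subalgebra.toSubmodule K ⊓ 𝒜 i)
      (Subalgebra.toSubmodule K ⊓ 𝒜 j) := by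
  have : tensorSubspace (Subalgebra.toSubmodule K) (Subalgebra.toSubmodule K) ≤
      (tensorSubspace (Subalgebra.toSubmodule K ⊓ 𝒜 i) (Subalgebra.toSubmodule K ⊓ 𝒜 j)).comap
      (TensorProduct.map (GradedAlgebra.proj 𝒜 i) (GradedAlgebra.proj 𝒜 j)) := by
    refine tensorSubspace_le fun a ha b hb => ?_
    rw [Submodule.mem_comap, TensorProduct.map_tmul]
    exact tmul_mem_tensorSubspace ⟨hK a ha i, proj_mem_degree i a⟩
      ⟨hK b hb j, proj_mem_degree j b⟩
  exact this hx

theorem comul_eq_sum_comulComponent (h𝒜 : IsGradedHopfAlgebra 𝒜) {m : ℕ} {x : H}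
    (hx : x ∈ 𝒜 m) : Coalgebra.comul (R := k) x =
      ∑ p ∈ Finset.HasAntidiagonal.antidiagonal m, comulComponent 𝒜 p.1 p.2 x := by
  have key : (⨆ p ∈ Finset.HasAntidiagonal.antidiagonal m, tensorSubspace (𝒜 p.1) (𝒜 p.2)) ≤
      LinearMap.eqLocus LinearMap.id (∑ p ∈ Finset.HasAntidiagonal.antidiagonal m,
        TensorProduct.map (GradedAlgebra.proj 𝒜 p.1) (GradedAlgebra.proj 𝒜 p.2)) := by
    refine iSup₂_le fun p hp => tensorSubspace_le fun a ha b hb => ?_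
    rw [LinearMap.mem_eqLocus, LinearMap.id_apply, LinearMap.sum_apply,
      Finset.sum_eq_single_of_mem p hp]
    · rw [TensorProduct.map_tmul, proj_same ha, proj_same hb]
    · intro q hq hqp
      rw [TensorProduct.map_tmul]
      by_cases h : p.1 = q.1
      · have h2 : p.2 ≠ q.2 := fun h2 => hqp (Prod.ext h.symm h2.symm)
        rw [proj_ne hb h2, TensorProduct.tmul_zero]
      · rw [proj_ne ha h, TensorProduct.zero_tmul]
  have := key (h𝒜.comul_mem m x hx)
  rw [LinearMap.mem_eqLocus, LinearMap.id_apply, LinearMap.sum_apply] at this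
  exact this

/-- Connectedness enters here: once the projection to degree zero is the counit, the counit axioms
determine the two extreme components of the coproduct. -/
theorem IsConnectedGradedHopfAlgebra.proj_zero (h𝒜 : IsConnectedGradedHopfAlgebra 𝒜) (x : H) :
    GradedAlgebra.proj 𝒜 0 x = algebraMap k H (Coalgebra.counit (R := k) x) := by
  refine DirectSum.Decomposition.inductionOn 𝒜 (motive := fun x =>
    GradedAlgebra.proj 𝒜 0 x = algebraMap k H (Coalgebra.counit (R := k) x)) (by simp)
    (fun {i} a => ?_) (fun a b ha hb => by simp only [map_add, ha, hb]) x
  by_cases h : i = 0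
  · subst h
    rw [proj_same a.2]
    have h1 : ∀ y ∈ 𝒜 0, y ∈ (1 : Submodule k H) := fun y hy => h𝒜.connected ▸ hy
    obtain ⟨c, hc⟩ := Submodule.mem_one.1 (h1 a a.2)
    rw [← hc, Bialgebra.counit_algebraMap]
  · rw [proj_ne a.2 h, h𝒜.counit_eq_zero i h a a.2, map_zero]

theorem IsConnectedGradedHopfAlgebra.comulComponent_zero_left
    (h𝒜 : IsConnectedGradedHopfAlgebra 𝒜) {m : ℕ} {x : H} (hx : x ∈ 𝒜 m) :
    comulComponent 𝒜 0 m x = 1 ⊗ₜ x := by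
  have h0 : GradedAlgebra.proj 𝒜 0 = Algebra.linearMap k H ∘ₗ Coalgebra.counit :=
    LinearMap.ext h𝒜.proj_zero
  have : TensorProduct.map (GradedAlgebra.proj 𝒜 0) (GradedAlgebra.proj 𝒜 m) =
      TensorProduct.map (Algebra.linearMap k H) (GradedAlgebra.proj 𝒜 m) ∘ₗ
        (Coalgebra.counit (R := k) (A := H)).rTensor H := by
    rw [h0, LinearMap.map_comp_rTensor]
  rw [comulComponent, this, LinearMap.comp_apply, Coalgebra.rTensor_counit_comul,
    TensorProduct.map_tmul, proj_same hx, Algebra.linearMap_apply, map_one]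

theorem IsConnectedGradedHopfAlgebra.comulComponent_zero_right
    (h𝒜 : IsConnectedGradedHopfAlgebra 𝒜) {m : ℕ} {x : H} (hx : x ∈ 𝒜 m) :
    comulComponent 𝒜 m 0 x = x ⊗ₜ 1 := by
  have h0 : GradedAlgebra.proj 𝒜 0 = Algebra.linearMap k H ∘ₗ Coalgebra.counit :=
    LinearMap.ext h𝒜.proj_zero
  have : TensorProduct.map (GradedAlgebra.proj 𝒜 m) (GradedAlgebra.proj 𝒜 0) =
      TensorProduct.map (GradedAlgebra.proj 𝒜 m) (Algebra.linearMap k H) ∘ₗ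
        (Coalgebra.counit (R := k) (A := H)).lTensor H := by
    rw [h0, LinearMap.map_comp_lTensor]
  rw [comulComponent, this, LinearMap.comp_apply, Coalgebra.lTensor_counit_comul,
    TensorProduct.map_tmul, proj_same hx, Algebra.linearMap_apply, map_one]

/-- Pairs of positive numbers with sum `m`. -/
def positiveAntidiagonal (m : ℕ) : Finset (ℕ × ℕ) :=
  {p ∈ Finset.HasAntidiagonal.antidiagonal m | p.1 ≠ 0 ∧ p.2 ≠ 0}

/-- The basis of the inductions on degree: both tensor factors of every remaining term have degree
strictly below `m`. -/
theorem IsConnectedGradedHopfAlgebra.comul_eq (h𝒜 : IsConnectedGradedHopfAlgebra 𝒜) {m : ℕ}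
    (hm : m ≠ 0) {x : H} (hx : x ∈ 𝒜 m) :
    Coalgebra.comul (R := k) x =
      x ⊗ₜ 1 + 1 ⊗ₜ x + ∑ p ∈ positiveAntidiagonal m, comulComponent 𝒜 p.1 p.2 x := by
  rw [comul_eq_sum_comulComponent h𝒜.toIsGradedHopfAlgebra hx, positiveAntidiagonal,
    ← Finset.sum_filter_add_sum_filter_not (Finset.HasAntidiagonal.antidiagonal m)
      (fun p : ℕ × ℕ => p.1 ≠ 0 ∧ p.2 ≠ 0), add_comm]
  congr 1
  have : ({p ∈ Finset.HasAntidiagonal.antidiagonal m | ¬(p.1 ≠ 0 ∧ p.2 ≠ 0)} : Finset (ℕ × ℕ)) =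
      {(m, 0), (0, m)} := by
    ext ⟨a, b⟩
    simp only [Finset.mem_filter, Finset.HasAntidiagonal.mem_antidiagonal, Finset.mem_insert,
      Finset.mem_singleton, Prod.mk.injEq]
    omega
  rw [this, Finset.sum_pair (by simp [hm]), h𝒜.comulComponent_zero_right hx,
    h𝒜.comulComponent_zero_left hx]

theorem IsGradedHopfSubalgebra.isHomogeneous {K : Subalgebra k H}
    (hK : IsGradedHopfSubalgebra 𝒜 K) : IsHomogeneousSubalgebra 𝒜 K :=
  hK.homogeneous

theorem IsConnectedGradedHopfAlgebra.degree_zero_le (h𝒜 : IsConnectedGradedHopfAlgebra 𝒜)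
    (K : Subalgebra k H) {x : H} (hx : x ∈ 𝒜 0) : x ∈ K := by
  rw [← proj_same hx, h𝒜.proj_zero]
  exact K.algebraMap_mem _

/-- In a connected graded Hopf algebra, a graded sub-bialgebra is a graded Hopf subalgebra. -/
theorem IsConnectedGradedHopfAlgebra.isGradedHopfSubalgebra
    (h𝒜 : IsConnectedGradedHopfAlgebra 𝒜) {K : Subalgebra k H}
    (hK : IsHomogeneousSubalgebra 𝒜 K)
    (hΔ : ∀ x ∈ K, Coalgebra.comul (R := k) x ∈ tensorSubalgebra K) :
    IsGradedHopfSubalgebra 𝒜 K := by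
  have key : ∀ n, ∀ x ∈ K, x ∈ 𝒜 n → HopfAlgebra.antipode k x ∈ K := by
    intro n
    induction n using Nat.strong_induction_on with
    | _ n ih =>
      intro x hx hxn
      by_cases hn : n = 0
      · subst hn
        exact h𝒜.degree_zero_le K (h𝒜.antipode_mem 0 x hxn)
      -- The antipode axiom, solved for `S x`: the other terms involve `S` only in degrees below
      -- `n`.
      have h1 := HopfAlgebra.mul_antipode_rTensor_comul_apply (R := k) x
      rw [h𝒜.counit_eq_zero n hn x hxn, map_zero, h𝒜.comul_eq hn hxn, map_add, map_add, map_add,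
        map_add, LinearMap.rTensor_tmul, LinearMap.rTensor_tmul, LinearMap.mul'_apply,
        LinearMap.mul'_apply, mul_one, HopfAlgebra.antipode_one, one_mul, add_assoc] at h1
      rw [eq_neg_of_add_eq_zero_left h1]
      refine neg_mem (add_mem hx ?_)
      rw [map_sum, map_sum]
      refine sum_mem fun p hp => ?_
      simp only [positiveAntidiagonal, Finset.mem_filter, Finset.HasAntidiagonal.mem_antidiagonal] at hp
      have h2 : tensorSubspace (Subalgebra.toSubmodule K ⊓ 𝒜 p.1)
          (Subalgebra.toSubmodule K ⊓ 𝒜 p.2) ≤ (Subalgebra.toSubmodule K).comap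
          (LinearMap.mul' k H ∘ₗ (HopfAlgebra.antipode k).rTensor H) := by
        refine tensorSubspace_le fun a ha b hb => ?_
        exact mul_mem (ih p.1 (by omega) a ha.1 ha.2) hb.1
      exact h2 (comulComponent_mem hK (hΔ x hx) p.1 p.2)
  refine ⟨⟨hΔ, fun x hx => ?_⟩, hK⟩
  refine induction_homogeneous (𝒜 := 𝒜) (p := fun y => HopfAlgebra.antipode k y ∈ K) x
    (fun a b ha hb => ?_) (by simp) fun n => key n _ (hK x hx n) (proj_mem_degree n x)
  rw [map_add]
  exact add_mem ha hb

theorem IsConnectedGradedHopfAlgebra.bot (h𝒜 : IsConnectedGradedHopfAlgebra 𝒜) :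
    IsGradedHopfSubalgebra 𝒜 (⊥ : Subalgebra k H) := by
  apply h𝒜.isGradedHopfSubalgebra
  · rw [← Algebra.adjoin_empty]
    exact isHomogeneousSubalgebra_adjoin (by simp)
  · intro x hx
    obtain ⟨c, rfl⟩ := Algebra.mem_bot.1 hx
    rw [Bialgebra.comul_algebraMap]
    exact Subalgebra.algebraMap_mem _ _

theorem IsConnectedGradedHopfAlgebra.top (h𝒜 : IsConnectedGradedHopfAlgebra 𝒜) :
    IsGradedHopfSubalgebra 𝒜 (⊤ : Subalgebra k H) := by
  apply h𝒜.isGradedHopfSubalgebra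
  · exact fun _ _ _ => Algebra.mem_top
  · intro x _
    induction Coalgebra.comul (R := k) x with
    | zero => exact zero_mem _
    | add x y hx hy => exact add_mem hx hy
    | tmul a b => exact tmul_mem_tensorSubalgebra Algebra.mem_top Algebra.mem_top

/-- The elements that are primitive modulo `K ⊗ K`. -/
def relPrimitive (K : Subalgebra k H) : Submodule k H :=
  (Subalgebra.toSubmodule (tensorSubalgebra K)).comap
    (Coalgebra.comul (R := k) - (TensorProduct.mk k H H).flip 1 - TensorProduct.mk k H H 1)

theorem mem_relPrimitive {K : Subalgebra k H} {z : H} : z ∈ relPrimitive K ↔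
    Coalgebra.comul (R := k) z - z ⊗ₜ 1 - 1 ⊗ₜ z ∈ tensorSubalgebra K :=
  Iff.rfl

theorem relPrimitive_mono {K L : Subalgebra k H} (h : K ≤ L) : relPrimitive K ≤ relPrimitive L :=
  fun _ hz => tensorSubalgebra_mono h hz

/-- Elements of minimal degree outside `K` are primitive modulo `K ⊗ K`. -/
theorem IsConnectedGradedHopfAlgebra.exists_relPrimitive (h𝒜 : IsConnectedGradedHopfAlgebra 𝒜)
    {K L : Subalgebra k H} (hL : IsGradedHopfSubalgebra 𝒜 L) (h : ¬ L ≤ K) :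
    ∃ m, ∃ z ∈ L, z ∈ 𝒜 m ∧ z ∉ K ∧ z ∈ relPrimitive K := by
  classical
  have hex : ∃ m, ∃ z ∈ L, z ∈ 𝒜 m ∧ z ∉ K := by
    by_contra! hcon
    refine h fun x hx => ?_
    exact induction_homogeneous (𝒜 := 𝒜) x (fun a b => add_mem) (zero_mem _)
      fun n => hcon n _ (hL.isHomogeneous x hx n) (proj_mem_degree n x)
  obtain ⟨z, hzL, hz, hzK⟩ := Nat.find_spec hex
  have hmin : ∀ n < Nat.find hex, ∀ y ∈ L, y ∈ 𝒜 n → y ∈ K := by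
    intro n hn y hy hyn
    by_contra hyK
    exact Nat.find_min hex hn ⟨y, hy, hyn, hyK⟩
  generalize Nat.find hex = m at *
  have hm : m ≠ 0 := by
    rintro rfl
    exact hzK (h𝒜.degree_zero_le K hz)
  refine ⟨m, z, hzL, hz, hzK, ?_⟩
  rw [mem_relPrimitive, h𝒜.comul_eq hm hz, add_assoc, add_sub_cancel_left, add_sub_cancel_left]
  -- Both degrees in `p` are below the minimal degree `m`, so both factors already lie in `K`.
  refine sum_mem fun p hp => ?_
  simp only [positiveAntidiagonal, Finset.mem_filter, Finset.HasAntidiagonal.mem_antidiagonal] at hp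
  refine mem_tensorSubalgebra.2 (tensorSubspace_mono ?_ ?_
    (comulComponent_mem hL.isHomogeneous (hL.comul_mem z hzL) p.1 p.2))
  · exact fun a ha => hmin p.1 (by omega) a ha.1 ha.2
  · exact fun a ha => hmin p.2 (by omega) a ha.1 ha.2

end Graded

/-! ### Adjoining one element, and derivations obtained by contracting the coproduct. -/

section Extension

variable {k H : Type*} [Field k] [Ring H] [HopfAlgebra k H]

/-- The subalgebra generated by `K` and `z`. -/
def adjoinElement (K : Subalgebra k H) (z : H) : Subalgebra k H :=
  Algebra.adjoin k (insert z (K : Set H))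

theorem le_adjoinElement (K : Subalgebra k H) (z : H) : K ≤ adjoinElement K z :=
  fun _ hx => Algebra.subset_adjoin (Or.inr hx)

theorem self_mem_adjoinElement (K : Subalgebra k H) (z : H) : z ∈ adjoinElement K z :=
  Algebra.subset_adjoin (Or.inl rfl)

theorem adjoinElement_le {K L : Subalgebra k H} {z : H} (h : K ≤ L) (hz : z ∈ L) :
    adjoinElement K z ≤ L :=
  Algebra.adjoin_le (Set.insert_subset hz h)

theorem tensorSubspace_induction {V W : Submodule k H} {p : H ⊗[k] H → Prop} (h0 : p 0)
    (hadd : ∀ s t, p s → p t → p (s + t)) (htmul : ∀ a ∈ V, ∀ b ∈ W, p (a ⊗ₜ b))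
    {t : H ⊗[k] H} (ht : t ∈ tensorSubspace V W) : p t := by
  obtain ⟨t, rfl⟩ := ht
  induction t with
  | zero => simpa using h0
  | add x y hx hy => rw [map_add]; exact hadd _ _ hx hy
  | tmul a b => exact htmul a a.2 b b.2

/-- The contraction of the left tensor factor with a linear functional. -/
noncomputable def leftApply (f : H →ₗ[k] k) : H ⊗[k] H →ₗ[k] H :=
  (TensorProduct.lid k H).toLinearMap ∘ₗ f.rTensor H

@[simp]
theorem leftApply_tmul (f : H →ₗ[k] k) (a b : H) : leftApply f (a ⊗ₜ b) = f a • b := by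
  simp [leftApply]

theorem leftApply_counit_comul (x : H) :
    leftApply (Coalgebra.counit (R := k)) (Coalgebra.comul (R := k) x) = x := by
  simp [leftApply, Coalgebra.rTensor_counit_comul]

theorem leftApply_mul {f : H →ₗ[k] k} {L : Subalgebra k H}
    (hf : ∀ x ∈ L, ∀ y ∈ L, f (x * y) =
      f x * Coalgebra.counit (R := k) y + Coalgebra.counit (R := k) x * f y)
    {s t : H ⊗[k] H} (hs : s ∈ tensorSubalgebra L) (ht : t ∈ tensorSubalgebra L) :
    leftApply f (s * t) = leftApply f s * leftApply (Coalgebra.counit (R := k)) t +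
      leftApply (Coalgebra.counit (R := k)) s * leftApply f t := by
  refine tensorSubspace_induction (p := fun s => leftApply f (s * t) =
    leftApply f s * leftApply (Coalgebra.counit (R := k)) t +
      leftApply (Coalgebra.counit (R := k)) s * leftApply f t) (by simp)
      (fun s s' h h' => ?_) (fun a ha b hb => ?_) (mem_tensorSubalgebra.1 hs)
  · rw [add_mul, map_add, map_add, map_add, h, h']
    noncomm_ring
  · refine tensorSubspace_induction (p := fun t => leftApply f (a ⊗ₜ b * t) =
      leftApply f (a ⊗ₜ b) * leftApply (Coalgebra.counit (R := k)) t +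
        leftApply (Coalgebra.counit (R := k)) (a ⊗ₜ b) * leftApply f t) (by simp)
        (fun t t' h h' => ?_) (fun c hc d hd => ?_) (mem_tensorSubalgebra.1 ht)
    · rw [mul_add, map_add, map_add, map_add, h, h']
      noncomm_ring
    · simp only [Algebra.TensorProduct.tmul_mul_tmul, leftApply_tmul, hf a ha c hc,
        smul_mul_smul_comm, add_smul]

/-- `Δ` is multiplicative and contracting with the counit recovers the element, so a functional that
is a derivation relative to the counit yields a genuine derivation of `L`. -/
theorem leftApply_comul_mul {f : H →ₗ[k] k} {L : Subalgebra k H}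
    (hL : ∀ x ∈ L, Coalgebra.comul (R := k) x ∈ tensorSubalgebra L)
    (hf : ∀ x ∈ L, ∀ y ∈ L, f (x * y) =
      f x * Coalgebra.counit (R := k) y + Coalgebra.counit (R := k) x * f y)
    {x y : H} (hx : x ∈ L) (hy : y ∈ L) :
    leftApply f (Coalgebra.comul (R := k) (x * y)) =
      leftApply f (Coalgebra.comul (R := k) x) * y +
        x * leftApply f (Coalgebra.comul (R := k) y) := by
  rw [Bialgebra.comul_mul, leftApply_mul hf (hL x hx) (hL y hy), leftApply_counit_comul,
    leftApply_counit_comul]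

theorem leftApply_eq_zero {f : H →ₗ[k] k} {K : Subalgebra k H} (hf : ∀ x ∈ K, f x = 0)
    {t : H ⊗[k] H} (ht : t ∈ tensorSubalgebra K) : leftApply f t = 0 :=
  tensorSubspace_induction (p := fun t => leftApply f t = 0) (map_zero _)
    (fun s t hs ht => by rw [map_add, hs, ht, add_zero])
    (fun a ha b _ => by rw [leftApply_tmul, hf a ha, zero_smul]) (mem_tensorSubalgebra.1 ht)

/-- As `Δ` is an algebra map, only the generators need checking; for `z` this is relative
primitivity. -/
theorem comul_mem_adjoinElement {K : Subalgebra k H}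
    (hK : ∀ x ∈ K, Coalgebra.comul (R := k) x ∈ tensorSubalgebra K) {z : H}
    (hz : z ∈ relPrimitive K) {x : H} (hx : x ∈ adjoinElement K z) :
    Coalgebra.comul (R := k) x ∈ tensorSubalgebra (adjoinElement K z) := by
  have : adjoinElement K z ≤
      (tensorSubalgebra (adjoinElement K z)).comap (Bialgebra.comulAlgHom k H) := by
    refine adjoinElement_le (fun y hy => tensorSubalgebra_mono (le_adjoinElement K z) (hK y hy)) ?_
    have h1 := tensorSubalgebra_mono (le_adjoinElement K z) (mem_relPrimitive.1 hz)
    have h2 := tmul_mem_tensorSubalgebra (self_mem_adjoinElement K z)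
      (one_mem (adjoinElement K z))
    have h3 := tmul_mem_tensorSubalgebra (one_mem (adjoinElement K z))
      (self_mem_adjoinElement K z)
    have h4 := add_mem (add_mem h1 h3) h2
    rwa [sub_add_cancel, sub_add_cancel] at h4
  exact this hx

/-- If some linear map behaves on `K[z]` like the derivative with respect to `z`, then the powers
of `z` are linearly independent over `K`. -/
theorem eq_zero_of_sum_mul_pow_eq_zero [CharZero k] {K : Subalgebra k H} {z : H} (D : H →ₗ[k] H)
    (hDK : ∀ x ∈ K, D x = 0) (hDz : ∀ x ∈ adjoinElement K z, D (x * z) = D x * z + x) (N : ℕ) :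
    ∀ a : ℕ → H, (∀ i, a i ∈ K) → ∑ i ∈ Finset.range N, a i * z ^ i = 0 →
      ∀ i < N, a i = 0 := by
  have hD : ∀ a ∈ K, ∀ n : ℕ, D (a * z ^ (n + 1)) = ((n + 1 : ℕ) : k) • (a * z ^ n) := by
    intro a ha n
    induction n with
    | zero => simpa [hDK a ha] using hDz a (le_adjoinElement K z ha)
    | succ n ih =>
      rw [pow_succ, ← mul_assoc, hDz _ (mul_mem (le_adjoinElement K z ha)
        (pow_mem (self_mem_adjoinElement K z) _)), ih, smul_mul_assoc, mul_assoc, ← pow_succ,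
        Nat.cast_succ (n + 1), add_smul, one_smul]
  induction N with
  | zero => simp
  | succ N ih =>
    intro a ha hsum
    have h1 : ∀ i < N, a (i + 1) = 0 := by
      -- Applying `D` shortens the relation and multiplies the coefficients by `i + 1`, which is
      -- nonzero in characteristic zero.
      have h2 : ∑ i ∈ Finset.range N, (((i + 1 : ℕ) : k) • a (i + 1)) * z ^ i = 0 := by
        have := congrArg D hsum
        rw [Finset.sum_range_succ', map_add, map_sum, map_zero, pow_zero, mul_one,
          hDK _ (ha 0), add_zero] at this
        rw [← this]
        exact Finset.sum_congr rfl fun i _ => by rw [hD _ (ha _), smul_mul_assoc]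
      intro i hi
      have := ih (fun i => ((i + 1 : ℕ) : k) • a (i + 1))
        (fun i => K.smul_mem (ha _) _) h2 i hi
      exact (smul_eq_zero.1 this).resolve_left (Nat.cast_ne_zero.2 (Nat.succ_ne_zero i))
    intro i hi
    rcases i with _ | i
    · rw [Finset.sum_range_succ', Finset.sum_eq_zero fun j hj => by
        rw [h1 j (Finset.mem_range.1 hj), zero_mul]] at hsum
      simpa using hsum
    · exact h1 i (by omega)

end Extension

/-! ### Independence of the powers of a relatively primitive element. -/

section GradedExtension

variable {k H : Type*} [Field k] [Ring H] [HopfAlgebra k H]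
  {𝒜 : ℕ → Submodule k H} [GradedAlgebra 𝒜]

theorem IsConnectedGradedHopfAlgebra.adjoinElement (h𝒜 : IsConnectedGradedHopfAlgebra 𝒜)
    {K : Subalgebra k H} (hK : IsGradedHopfSubalgebra 𝒜 K) {m : ℕ} {z : H} (hz : z ∈ 𝒜 m)
    (hzK : z ∈ relPrimitive K) : IsGradedHopfSubalgebra 𝒜 (adjoinElement K z) :=
  h𝒜.isGradedHopfSubalgebra (hK.isHomogeneous.adjoin_insert hz)
    fun _ hx => comul_mem_adjoinElement hK.comul_mem hzK hx

variable (𝒜) in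
/-- The elements all of whose components have degree greater than `m`. -/
noncomputable def degreeGT (m : ℕ) : Submodule k H :=
  ⨅ i ∈ Finset.range (m + 1), LinearMap.ker (GradedAlgebra.proj 𝒜 i)

theorem mem_degreeGT {m : ℕ} {x : H} :
    x ∈ degreeGT 𝒜 m ↔ ∀ i ≤ m, GradedAlgebra.proj 𝒜 i x = 0 := by
  simp only [degreeGT, Submodule.mem_iInf, Finset.mem_range, LinearMap.mem_ker,
    Nat.lt_succ_iff]

theorem mul_mem_degreeGT_left {m : ℕ} {x : H} (hx : x ∈ degreeGT 𝒜 m) (y : H) :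
    x * y ∈ degreeGT 𝒜 m := by
  refine induction_homogeneous (𝒜 := 𝒜) (p := fun w => w * y ∈ degreeGT 𝒜 m) x
    (fun a b ha hb => ?_) (by simp) fun n => ?_
  · rw [add_mul]; exact add_mem ha hb
  · by_cases hn : n ≤ m
    · rw [mem_degreeGT.1 hx n hn, zero_mul]; exact zero_mem _
    · exact mem_degreeGT.2 fun i hi => DirectSum.coe_decompose_mul_of_left_mem_of_not_le 𝒜
        (proj_mem_degree n x) (by omega)

theorem mul_mem_degreeGT_right {m : ℕ} (y : H) {x : H} (hx : x ∈ degreeGT 𝒜 m) :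
    y * x ∈ degreeGT 𝒜 m := by
  refine induction_homogeneous (𝒜 := 𝒜) (p := fun w => y * w ∈ degreeGT 𝒜 m) x
    (fun a b ha hb => ?_) (by simp) fun n => ?_
  · rw [mul_add]; exact add_mem ha hb
  · by_cases hn : n ≤ m
    · rw [mem_degreeGT.1 hx n hn, mul_zero]; exact zero_mem _
    · exact mem_degreeGT.2 fun i hi => DirectSum.coe_decompose_mul_of_right_mem_of_not_le 𝒜
        (proj_mem_degree n x) (by omega)

theorem mul_homogeneous_mem_degreeGT {m : ℕ} {z a : H} (hz : z ∈ 𝒜 m)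
    (ha : GradedAlgebra.proj 𝒜 0 a = 0) : a * z ∈ degreeGT 𝒜 m := by
  refine mem_degreeGT.2 fun i hi => ?_
  rw [GradedAlgebra.proj_apply] at ha ⊢
  rw [DirectSum.coe_decompose_mul_of_right_mem 𝒜 i hz]
  split_ifs
  · rw [show i - m = 0 by omega, ha, zero_mul]
  · rfl

theorem homogeneous_mul_mem_degreeGT {m : ℕ} {z a : H} (hz : z ∈ 𝒜 m)
    (ha : GradedAlgebra.proj 𝒜 0 a = 0) : z * a ∈ degreeGT 𝒜 m := by
  refine mem_degreeGT.2 fun i hi => ?_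
  rw [GradedAlgebra.proj_apply] at ha ⊢
  rw [DirectSum.coe_decompose_mul_of_left_mem 𝒜 i hz]
  split_ifs
  · rw [show i - m = 0 by omega, ha, mul_zero]
  · rfl

theorem IsConnectedGradedHopfAlgebra.proj_zero_sub_counit (h𝒜 : IsConnectedGradedHopfAlgebra 𝒜)
    (a : H) : GradedAlgebra.proj 𝒜 0 (a - algebraMap k H (Coalgebra.counit (R := k) a)) = 0 := by
  rw [h𝒜.proj_zero, map_sub, Bialgebra.counit_algebraMap, sub_self, map_zero]

/-- Modulo degrees above `m`, both `a * z` and `z * a` reduce to `ε(a) z`, and `z * z` vanishes.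
Hence the coefficient of `z` obeys the Leibniz rule relative to the counit. -/
theorem IsConnectedGradedHopfAlgebra.mul_sub_mem_degreeGT (h𝒜 : IsConnectedGradedHopfAlgebra 𝒜)
    {m : ℕ} (hm : m ≠ 0) {z : H} (hz : z ∈ 𝒜 m) {x a y b : H} {c d : k}
    (hx : x - a - c • z ∈ degreeGT 𝒜 m) (hy : y - b - d • z ∈ degreeGT 𝒜 m) :
    x * y - a * b -
      (c * Coalgebra.counit (R := k) b + Coalgebra.counit (R := k) a * d) • z ∈ degreeGT 𝒜 m := by
  have h1 := mul_mem_degreeGT_left hx y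
  have h2 := mul_mem_degreeGT_right (a + c • z) hy
  have h3 := Submodule.smul_mem _ d (mul_homogeneous_mem_degreeGT hz (h𝒜.proj_zero_sub_counit a))
  have h4 := Submodule.smul_mem _ c (homogeneous_mul_mem_degreeGT hz (h𝒜.proj_zero_sub_counit b))
  have h5 := Submodule.smul_mem _ (c * d) (mul_homogeneous_mem_degreeGT hz (proj_ne hz hm))
  have := add_mem (add_mem (add_mem (add_mem h1 h2) h3) h4) h5
  convert this using 1
  simp only [sub_mul, mul_sub, add_mul, smul_sub, add_smul, smul_mul_assoc, mul_smul_comm,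
    ← Algebra.smul_def, ← Algebra.commutes]
  module

theorem IsConnectedGradedHopfAlgebra.exists_sub_mem_degreeGT
    (h𝒜 : IsConnectedGradedHopfAlgebra 𝒜) {K : Subalgebra k H} {m : ℕ} (hm : m ≠ 0) {z : H}
    (hz : z ∈ 𝒜 m) {x : H} (hx : x ∈ _root_.adjoinElement K z) :
    ∃ a ∈ K, ∃ c : k, x - a - c • z ∈ degreeGT 𝒜 m := by
  induction hx using Algebra.adjoin_induction with
  | mem x hx =>
    rcases hx with rfl | hx
    · exact ⟨0, zero_mem _, 1, by simp⟩
    · exact ⟨x, hx, 0, by simp⟩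
  | algebraMap r => exact ⟨_, K.algebraMap_mem r, 0, by simp⟩
  | add x y _ _ hx hy =>
    obtain ⟨a, ha, c, hc⟩ := hx
    obtain ⟨b, hb, d, hd⟩ := hy
    refine ⟨a + b, add_mem ha hb, c + d, ?_⟩
    convert add_mem hc hd using 1
    rw [add_smul]
    abel
  | mul x y _ _ hx hy =>
    obtain ⟨a, ha, c, hc⟩ := hx
    obtain ⟨b, hb, d, hd⟩ := hy
    exact ⟨a * b, mul_mem ha hb, _, h𝒜.mul_sub_mem_degreeGT hm hz hc hd⟩

/-- Adjoining an element of degree `m` does not change the components of degree less than `m`. -/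
theorem IsConnectedGradedHopfAlgebra.mem_of_mem_adjoinElement
    (h𝒜 : IsConnectedGradedHopfAlgebra 𝒜) {K : Subalgebra k H}
    (hK : IsHomogeneousSubalgebra 𝒜 K) {m : ℕ} {z : H} (hz : z ∈ 𝒜 m) {n : ℕ} (hn : n < m)
    {x : H} (hx : x ∈ _root_.adjoinElement K z) (hxn : x ∈ 𝒜 n) : x ∈ K := by
  obtain ⟨a, ha, c, hc⟩ := h𝒜.exists_sub_mem_degreeGT (by omega) hz hx
  have h := mem_degreeGT.1 hc n hn.le
  rw [map_sub, map_sub, map_smul, proj_ne hz (by omega), smul_zero, sub_zero, proj_same hxn,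
    sub_eq_zero] at h
  rw [h]
  exact hK a ha n

/-- `D` is the contraction of `Δ` with a functional `f` that vanishes on `K` and in all degrees
other than `m`, with `f z = 1`. Modulo degrees above `m`, `K[z]` is `K + k z`, so there `f` reads
off the coefficient of `z`. -/
theorem IsConnectedGradedHopfAlgebra.exists_derivative (h𝒜 : IsConnectedGradedHopfAlgebra 𝒜)
    {K : Subalgebra k H} (hK : IsGradedHopfSubalgebra 𝒜 K) {m : ℕ} {z : H} (hz : z ∈ 𝒜 m)
    (hzP : z ∈ relPrimitive K) (hzK : z ∉ K) :
    ∃ D : H →ₗ[k] H, (∀ x ∈ K, D x = 0) ∧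
      ∀ x ∈ _root_.adjoinElement K z, D (x * z) = D x * z + x := by
  have hm : m ≠ 0 := by
    rintro rfl
    exact hzK (h𝒜.degree_zero_le K hz)
  obtain ⟨g, hgz, hgK⟩ :=
    Submodule.exists_le_ker_of_notMem (p := Subalgebra.toSubmodule K) (v := z) hzK
  let f : H →ₗ[k] k := (g z)⁻¹ • g ∘ₗ GradedAlgebra.proj 𝒜 m
  have hfK : ∀ x ∈ K, f x = 0 := fun x hx => by
    have : g (GradedAlgebra.proj 𝒜 m x) = 0 := hgK (hK.isHomogeneous x hx m)
    simp only [f, LinearMap.smul_apply, LinearMap.comp_apply, this, smul_zero]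
  have hfz : f z = 1 := by
    simp only [f, LinearMap.smul_apply, LinearMap.comp_apply, proj_same hz, smul_eq_mul]
    exact inv_mul_cancel₀ hgz
  have hfG : ∀ x ∈ degreeGT 𝒜 m, f x = 0 := fun x hx => by
    simp only [f, LinearMap.smul_apply, LinearMap.comp_apply, mem_degreeGT.1 hx m le_rfl,
      map_zero, smul_zero]
  have hεG : ∀ x ∈ degreeGT 𝒜 m, Coalgebra.counit (R := k) x = 0 := fun x hx => by
    have h := mem_degreeGT.1 hx 0 (Nat.zero_le m)
    rw [h𝒜.proj_zero] at h
    rw [← Bialgebra.counit_algebraMap (A := H) (Coalgebra.counit (R := k) x), h, map_zero]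
  have hεz := h𝒜.counit_eq_zero m hm z hz
  have hfx : ∀ x a : H, ∀ c : k, a ∈ K → x - a - c • z ∈ degreeGT 𝒜 m → f x = c := by
    intro x a c ha h
    have := hfG _ h
    rwa [map_sub, map_sub, hfK a ha, map_smul, hfz, sub_zero, smul_eq_mul, mul_one,
      sub_eq_zero] at this
  have hεx : ∀ x a : H, ∀ c : k, x - a - c • z ∈ degreeGT 𝒜 m →
      Coalgebra.counit (R := k) x = Coalgebra.counit (R := k) a := by
    intro x a c h
    have := hεG _ h
    rwa [map_sub, map_sub, map_smul, hεz, smul_zero, sub_zero, sub_eq_zero] at this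
  have hf : ∀ x ∈ _root_.adjoinElement K z, ∀ y ∈ _root_.adjoinElement K z, f (x * y) =
      f x * Coalgebra.counit (R := k) y + Coalgebra.counit (R := k) x * f y := by
    intro x hx y hy
    obtain ⟨a, ha, c, hc⟩ := h𝒜.exists_sub_mem_degreeGT hm hz hx
    obtain ⟨b, hb, d, hd⟩ := h𝒜.exists_sub_mem_degreeGT hm hz hy
    rw [hfx _ _ _ (mul_mem ha hb) (h𝒜.mul_sub_mem_degreeGT hm hz hc hd), hfx x a c ha hc,
      hfx y b d hb hd, hεx x a c hc, hεx y b d hd]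
  refine ⟨leftApply f ∘ₗ Coalgebra.comul, fun x hx =>
    leftApply_eq_zero hfK (hK.comul_mem x hx), fun x hx => ?_⟩
  -- Only `z ⊗ 1` survives: `f` kills `1` and the left factors of the `K ⊗ K` part.
  have hDz : leftApply f (Coalgebra.comul (R := k) z) = 1 := by
    have h := leftApply_eq_zero hfK (mem_relPrimitive.1 hzP)
    rwa [map_sub, map_sub, leftApply_tmul, leftApply_tmul, hfz, hfK 1 (one_mem K),
      one_smul, zero_smul, sub_zero, sub_eq_zero] at h
  rw [LinearMap.comp_apply, LinearMap.comp_apply, leftApply_comul_mul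
    (fun y hy => comul_mem_adjoinElement hK.comul_mem hzP hy) hf hx
    (self_mem_adjoinElement K z), hDz, mul_one]

theorem IsConnectedGradedHopfAlgebra.linearIndependent_pow [CharZero k]
    (h𝒜 : IsConnectedGradedHopfAlgebra 𝒜) {K : Subalgebra k H}
    (hK : IsGradedHopfSubalgebra 𝒜 K) {m : ℕ} {z : H} (hz : z ∈ 𝒜 m)
    (hzP : z ∈ relPrimitive K) (hzK : z ∉ K) : LinearIndependent K (fun i : ℕ => z ^ i) := by
  classical
  obtain ⟨D, hDK, hDz⟩ := h𝒜.exists_derivative hK hz hzP hzK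
  rw [linearIndependent_iff']
  intro s g hg i hi
  let a : ℕ → H := fun i => if i ∈ s then (g i : H) else 0
  have ha : ∀ i, a i ∈ K := fun i => by
    simp only [a]; split_ifs; exacts [(g i).2, zero_mem _]
  have hsub : s ⊆ Finset.range (s.sup id + 1) := fun j hj => by
    have : id j ≤ _ := Finset.le_sup (f := id) hj
    simp only [id] at this
    simp only [Finset.mem_range]
    omega
  have hsum : ∑ i ∈ Finset.range (s.sup id + 1), a i * z ^ i = 0 := by
    rw [← hg, ← Finset.sum_subset hsub fun j _ hj => by simp only [a, if_neg hj, zero_mul]]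
    exact Finset.sum_congr rfl fun j hj => by simp only [a, if_pos hj]; rfl
  have := eq_zero_of_sum_mul_pow_eq_zero D hDK hDz _ a ha hsum i (Finset.mem_range.1 (hsub hi))
  simp only [a, if_pos hi] at this
  exact Subtype.ext this

end GradedExtension

/-! ### The Ore relation and chains of extensions of derivation type. -/

section Ore

variable {k H : Type*} [Field k] [Ring H] [HopfAlgebra k H]
  {𝒜 : ℕ → Submodule k H} [GradedAlgebra 𝒜]

/-- Write `v` and `w` for the non-primitive parts of `Δr` and `Δz`. Since `z ⊗ 1` commutes with `1 ⊗
r`, and `1 ⊗ z` with `r ⊗ 1`, the non-primitive part of `Δ[z, r]` is `[z ⊗ 1, v] + [1 ⊗ z, v] + [w,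
Δr]`. -/
theorem commutator_mem_relPrimitive {K : Subalgebra k H} {z r : H}
    (hz : z ∈ relPrimitive K) (hr : Coalgebra.comul (R := k) r ∈ tensorSubalgebra K)
    {T : Submodule k H} (hT : T ≤ Subalgebra.toSubmodule K)
    (hrT : Coalgebra.comul (R := k) r - r ⊗ₜ 1 - 1 ⊗ₜ r ∈ tensorSubspace T T)
    (hzT : ∀ a ∈ T, z * a - a * z ∈ K) : z * r - r * z ∈ relPrimitive K := by
  have hcomm : ∀ w : H ⊗[k] H, (∀ a ∈ T, ∀ b ∈ T,
      w * (a ⊗ₜ[k] b) - (a ⊗ₜ[k] b) * w ∈ tensorSubalgebra K) → ∀ v ∈ tensorSubspace T T,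
      w * v - v * w ∈ tensorSubalgebra K := by
    intro w hw v hv
    refine tensorSubspace_induction (p := fun v => w * v - v * w ∈ tensorSubalgebra K) (by simp)
      (fun s t hs ht => ?_) hw hv
    convert add_mem hs ht using 1
    noncomm_ring
  have h1 := hcomm (z ⊗ₜ 1) (fun a ha b hb => by
    rw [Algebra.TensorProduct.tmul_mul_tmul, Algebra.TensorProduct.tmul_mul_tmul, one_mul,
      mul_one, ← TensorProduct.sub_tmul]
    exact tmul_mem_tensorSubalgebra (hzT a ha) (hT hb)) _ hrT
  have h2 := hcomm (1 ⊗ₜ z) (fun a ha b hb => by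
    rw [Algebra.TensorProduct.tmul_mul_tmul, Algebra.TensorProduct.tmul_mul_tmul, one_mul,
      mul_one, ← TensorProduct.tmul_sub]
    exact tmul_mem_tensorSubalgebra (hT ha) (hzT b hb)) _ hrT
  have h3 := sub_mem (mul_mem (mem_relPrimitive.1 hz) hr) (mul_mem hr (mem_relPrimitive.1 hz))
  rw [mem_relPrimitive]
  convert add_mem (add_mem h1 h2) h3 using 1
  simp only [map_sub, Bialgebra.comul_mul, TensorProduct.sub_tmul, TensorProduct.tmul_sub,
    sub_mul, mul_sub, Algebra.TensorProduct.tmul_mul_tmul, one_mul, mul_one]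
  abel

/-- An element of maximal degree among those that are primitive modulo `K ⊗ K` and not in `K`
normalizes `K`. -/
theorem IsConnectedGradedHopfAlgebra.commutator_mem (h𝒜 : IsConnectedGradedHopfAlgebra 𝒜)
    {K L : Subalgebra k H} (hK : IsGradedHopfSubalgebra 𝒜 K) (hKL : K ≤ L) {m : ℕ} {z : H}
    (hzL : z ∈ L) (hz : z ∈ 𝒜 m) (hzP : z ∈ relPrimitive K)
    (hmax : ∀ n, m < n → ∀ y ∈ L, y ∈ 𝒜 n → y ∈ relPrimitive K → y ∈ K)
    {r : H} (hr : r ∈ K) : z * r - r * z ∈ K := by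
  have key : ∀ n, ∀ r ∈ K, r ∈ 𝒜 n → z * r - r * z ∈ K := by
    intro n
    induction n using Nat.strong_induction_on with
    | _ n ih =>
      intro r hr hrn
      -- For `n ≠ 0` the commutator has degree `m + n > m`, so by maximality it suffices that it be
      -- relatively primitive.
      by_cases hn : n = 0
      · subst hn
        rw [← proj_same hrn, h𝒜.proj_zero, Algebra.commutes, sub_self]
        exact zero_mem _
      refine hmax (m + n) (by omega) _
        (sub_mem (mul_mem hzL (hKL hr)) (mul_mem (hKL hr) hzL))
        (sub_mem (mul_mem_degree hz hrn) (add_comm n m ▸ mul_mem_degree hrn hz)) ?_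
      refine commutator_mem_relPrimitive hzP (hK.comul_mem r hr)
        -- The part of `K` in degrees below `n`, where the induction hypothesis applies.
        (T := ⨆ i ∈ Finset.range n, Subalgebra.toSubmodule K ⊓ 𝒜 i)
        (iSup₂_le fun i _ => inf_le_left) ?_ ?_
      · rw [h𝒜.comul_eq hn hrn, add_assoc, add_sub_cancel_left, add_sub_cancel_left]
        refine sum_mem fun p hp => ?_
        simp only [positiveAntidiagonal, Finset.mem_filter,
          Finset.HasAntidiagonal.mem_antidiagonal] at hp
        refine tensorSubspace_mono ?_ ?_
          (comulComponent_mem hK.isHomogeneous (hK.comul_mem r hr) p.1 p.2)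
        · exact le_iSup₂_of_le p.1 (Finset.mem_range.2 (by omega)) le_rfl
        · exact le_iSup₂_of_le p.2 (Finset.mem_range.2 (by omega)) le_rfl
      · have : (⨆ i ∈ Finset.range n, Subalgebra.toSubmodule K ⊓ 𝒜 i) ≤
            (Subalgebra.toSubmodule K).comap (LinearMap.mulLeft k z - LinearMap.mulRight k z) :=
          iSup₂_le fun i hi a ha => ih i (Finset.mem_range.1 hi) a ha.1 ha.2
        exact fun a ha => this ha
  refine induction_homogeneous (𝒜 := 𝒜) (p := fun r => z * r - r * z ∈ K) r
    (fun a b ha hb => ?_) (by simp) fun n => key n _ (hK.isHomogeneous r hr n)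
      (proj_mem_degree n r)
  convert add_mem ha hb using 1
  noncomm_ring

/-- The identity `z (a y) = a (z y) + [z, a] y` makes the left span of the powers stable under left
multiplication by `z`, hence by all of `K[z]`; and it contains `1`. -/
theorem span_pow_eq_adjoinElement {K : Subalgebra k H} {z : H}
    (hz : ∀ r ∈ K, z * r - r * z ∈ K) :
    (Submodule.span K (Set.range fun i : ℕ => z ^ i) : Set H) = adjoinElement K z := by
  apply Set.Subset.antisymm
  · intro x hx
    induction hx using Submodule.span_induction with
    | mem x hx =>
      obtain ⟨i, rfl⟩ := hx
      exact pow_mem (self_mem_adjoinElement K z) i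
    | zero => exact zero_mem (adjoinElement K z)
    | add x y _ _ hx hy => exact add_mem (S := Subalgebra k H) hx hy
    | smul a x _ hx => exact mul_mem (S := Subalgebra k H) (le_adjoinElement K z a.2) hx
  · have hpow : ∀ i : ℕ, z ^ i ∈ Submodule.span K (Set.range fun i : ℕ => z ^ i) :=
      fun i => Submodule.subset_span ⟨i, rfl⟩
    have hmul : ∀ x ∈ adjoinElement K z, ∀ y ∈ Submodule.span K (Set.range fun i : ℕ => z ^ i),
        x * y ∈ Submodule.span K (Set.range fun i : ℕ => z ^ i) := by
      intro x hx
      induction hx using Algebra.adjoin_induction with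
      | mem x hx =>
        rcases hx with rfl | hx
        · intro y hy
          induction hy using Submodule.span_induction with
          | mem y hy =>
            obtain ⟨i, rfl⟩ := hy
            simpa only [← pow_succ'] using hpow (i + 1)
          | zero => simp
          | add y w _ _ hy hw => rw [mul_add]; exact add_mem hy hw
          | smul a y hy' hy =>
            have h1 := Submodule.smul_mem _ (⟨_, hz a a.2⟩ : K) hy'
            have h2 := Submodule.smul_mem _ a hy
            convert add_mem h1 h2 using 1
            simp only [Subalgebra.smul_def, smul_eq_mul]
            noncomm_ring
        · exact fun y hy => Submodule.smul_mem _ (⟨x, hx⟩ : K) hy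
      | algebraMap r =>
        exact fun y hy => Submodule.smul_mem _ (⟨_, K.algebraMap_mem r⟩ : K) hy
      | add x w _ _ hx hw => intro y hy; rw [add_mul]; exact add_mem (hx y hy) (hw y hy)
      | mul x w _ _ hx hw => intro y hy; rw [mul_assoc]; exact hx _ (hw y hy)
    intro x hx
    have := hmul x hx 1 (by simpa using hpow 0)
    rwa [mul_one] at this

theorem IsConnectedGradedHopfAlgebra.isGradedHOEOfDerivationType [CharZero k]
    (h𝒜 : IsConnectedGradedHopfAlgebra 𝒜) {K : Subalgebra k H}
    (hK : IsGradedHopfSubalgebra 𝒜 K) {m : ℕ} {z : H} (hz : z ∈ 𝒜 m)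
    (hzP : z ∈ relPrimitive K) (hzK : z ∉ K) (hcomm : ∀ r ∈ K, z * r - r * z ∈ K) :
    IsGradedHOEOfDerivationType 𝒜 K (_root_.adjoinElement K z) where
  left := hK
  right := h𝒜.adjoinElement hK hz hzP
  le := le_adjoinElement K z
  exists_ore := by
    let δ : K →ₗ[k] K :=
      ((LinearMap.mulLeft k z - LinearMap.mulRight k z) ∘ₗ
        (Subalgebra.toSubmodule K).subtype).codRestrict (Subalgebra.toSubmodule K)
        fun r => hcomm r r.2
    have hδ : ∀ r : K, (δ r : H) = z * r - r * z := fun r => rfl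
    refine ⟨z, m, δ, ⟨⟨fun a b => ?_, fun r => ?_, h𝒜.linearIndependent_pow hK hz hzP hzK,
      span_pow_eq_adjoinElement hcomm⟩, hz, fun j r hr => hr, fun j r hr => ?_⟩⟩
    · apply Subtype.ext
      simp only [hδ, Subalgebra.coe_add, Subalgebra.coe_mul, AlgEquiv.coe_refl, id]
      noncomm_ring
    · simp only [hδ, AlgEquiv.coe_refl, id]
      abel
    · rw [hδ]
      exact sub_mem (add_comm m j ▸ mul_mem_degree hz hr) (mul_mem_degree hr hz)

variable (𝒜) in
/-- `DerivationTypeChain 𝒜 n K L`: the graded Hopf subalgebra `L` is an `n`-step iterated graded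
Hopf Ore extension of derivation type of the graded Hopf subalgebra `K`. -/
inductive DerivationTypeChain : ℕ → Subalgebra k H → Subalgebra k H → Prop
  | refl (K : Subalgebra k H) (hK : IsGradedHopfSubalgebra 𝒜 K) : DerivationTypeChain 0 K K
  | cons {n : ℕ} {K M L : Subalgebra k H} (h : IsGradedHOEOfDerivationType 𝒜 K M)
      (hc : DerivationTypeChain n M L) : DerivationTypeChain (n + 1) K L

theorem DerivationTypeChain.trans {n n' : ℕ} {K M L : Subalgebra k H}
    (h : DerivationTypeChain 𝒜 n K M) (h' : DerivationTypeChain 𝒜 n' M L) :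
    DerivationTypeChain 𝒜 (n' + n) K L := by
  induction h with
  | refl => exact h'
  | cons h _ ih => exact .cons h (ih h')

theorem DerivationTypeChain.isGradedIHOEOfDerivationType {n : ℕ} {K : Subalgebra k H}
    (h : DerivationTypeChain 𝒜 n K ⊤) : IsGradedIHOEOfDerivationType 𝒜 n K := by
  generalize hT : (⊤ : Subalgebra k H) = T at h
  induction h with
  | refl K hK =>
    exact ⟨fun _ => K, rfl, hT.symm, fun _ => hK, fun i => i.elim0⟩
  | @cons n K M L h _ ih =>
    obtain ⟨C, hC0, hCl, hC, hstep⟩ := ih hT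
    refine ⟨Fin.cons K C, Fin.cons_zero _ _, ?_, fun i => ?_, fun i => ?_⟩
    · rw [← Fin.succ_last, Fin.cons_succ, hCl]
    · refine Fin.cases ?_ (fun i => ?_) i
      · exact h.left
      · exact hC i
    · refine Fin.cases ?_ (fun i => ?_) i
      · rw [Fin.castSucc_zero, Fin.cons_zero, Fin.cons_succ, hC0]
        exact h
      · rw [Fin.cons_succ, ← Fin.succ_castSucc, Fin.cons_succ]
        exact hstep i

end Ore

/-! ### Polynomial growth from below and above, and existence of chains. -/

section Growth

variable {k H : Type*} [Field k] [Ring H] [HopfAlgebra k H]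

/-- `K` contains a finite dimensional subspace `V ∋ 1` with `dim Vⁿ` at least the number of
monomials of degree at most `n` in `s` variables. -/
def HasGrowth (K : Subalgebra k H) (s : ℕ) : Prop :=
  ∃ V : Submodule k H, V ≤ Subalgebra.toSubmodule K ∧ V.FG ∧ 1 ≤ V ∧
    ∀ n : ℕ, (n + s).choose s ≤ Module.finrank k (V ^ n : Submodule k H)

theorem HasGrowth.mono {K L : Subalgebra k H} {s : ℕ} (h : HasGrowth K s) (hKL : K ≤ L) :
    HasGrowth L s := by
  obtain ⟨V, hV, h⟩ := h
  exact ⟨V, hV.trans hKL, h⟩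

theorem hasGrowth_zero (K : Subalgebra k H) : HasGrowth K 0 := by
  have : Nontrivial H := Bialgebra.nontrivial (R := k)
  refine ⟨1, Submodule.one_le.2 (one_mem K), ?_, le_rfl, fun n => ?_⟩
  · rw [Submodule.one_eq_span]
    exact Submodule.fg_span_singleton 1
  · rw [one_pow, Submodule.one_eq_span, finrank_span_singleton one_ne_zero]
    simp

/-- Monomials of degree at most `n` in `s + 1` variables, sorted by the exponent `i` of the last
variable. -/
theorem sum_choose_reflect (n s : ℕ) :
    ∑ i : Fin (n + 1), (n - i + s).choose s = (n + (s + 1)).choose (s + 1) := by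
  rw [Fin.sum_univ_eq_sum_range (fun i => (n - i + s).choose s),
    ← Finset.sum_range_reflect (fun i => (n - i + s).choose s)]
  induction n with
  | zero => simp
  | succ n ih =>
    rw [Finset.sum_range_succ]
    have : ∑ i ∈ Finset.range (n + 1), (n + 1 - (n + 1 + 1 - 1 - i) + s).choose s =
        ∑ i ∈ Finset.range (n + 1), (n - (n + 1 - 1 - i) + s).choose s :=
      Finset.sum_congr rfl fun i hi => by
        rw [Finset.mem_range] at hi
        congr 2
        omega
    rw [this, ih, show n + 1 + (s + 1) = (n + (s + 1)) + 1 by ring, Nat.choose_succ_succ',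
      add_comm]
    congr 2
    omega

/-- The `n`-th power of `V + k z` contains all `V ^ (n - i) * z ^ i`, and their sum is direct by
independence. No commutation relation is needed, so this also serves for elements that do not
normalize `K`. -/
theorem HasGrowth.succ {K L : Subalgebra k H} {s : ℕ} (h : HasGrowth K s) (hKL : K ≤ L) {z : H}
    (hzL : z ∈ L) (hz : LinearIndependent K (fun i : ℕ => z ^ i)) : HasGrowth L (s + 1) := by
  obtain ⟨V, hVK, hfg, h1, hV⟩ := h
  have hpowK : ∀ n, V ^ n ≤ Subalgebra.toSubmodule K := fun n => by
    induction n with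
    | zero => rw [pow_zero]; exact Submodule.one_le.2 (one_mem K)
    | succ n ih =>
      rw [pow_succ]
      exact Submodule.mul_le.2 fun a ha b hb => mul_mem (S := Subalgebra k H) (ih ha) (hVK hb)
  have hfgs : (V ⊔ Submodule.span k {z}).FG := hfg.sup (Submodule.fg_span_singleton z)
  refine ⟨V ⊔ Submodule.span k {z}, sup_le (hVK.trans hKL) ?_, hfgs, h1.trans le_sup_left,
    fun n => ?_⟩
  · rwa [Submodule.span_singleton_le_iff_mem]
  · have hfin : ∀ i, FiniteDimensional k (V ^ i : Submodule k H) := fun i =>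
      Module.Finite.iff_fg.2 (hfg.pow i)
    have hfin' : FiniteDimensional k ((V ⊔ Submodule.span k {z}) ^ n : Submodule k H) :=
      Module.Finite.iff_fg.2 (hfgs.pow n)
    let Φ : ((i : Fin (n + 1)) → (V ^ (n - i) : Submodule k H)) →ₗ[k] H :=
      ∑ i : Fin (n + 1), LinearMap.mulRight k (z ^ (i : ℕ)) ∘ₗ (V ^ (n - i)).subtype ∘ₗ
        LinearMap.proj i
    have hΦ : ∀ a, Φ a = ∑ i : Fin (n + 1), (a i : H) * z ^ (i : ℕ) := fun a => by
      simp [Φ, LinearMap.sum_apply]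
    have hinj : Function.Injective Φ := by
      rw [← LinearMap.ker_eq_bot, LinearMap.ker_eq_bot']
      intro a ha
      have hli := hz.comp (fun i : Fin (n + 1) => (i : ℕ)) Fin.val_injective
      rw [Fintype.linearIndependent_iff] at hli
      have := hli (fun i => ⟨a i, hpowK _ (a i).2⟩) (by rw [← ha, hΦ]; rfl)
      funext i
      exact Subtype.ext (congrArg (fun x : K => (x : H)) (this i))
    have hrange : LinearMap.range Φ ≤ (V ⊔ Submodule.span k {z}) ^ n := by
      rintro _ ⟨a, rfl⟩
      rw [hΦ]
      refine sum_mem fun i _ => ?_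
      have hi : (n - (i : ℕ)) + i = n := Nat.sub_add_cancel (Nat.lt_succ_iff.1 i.2)
      have hmem : (a i : H) * z ^ (i : ℕ) ∈
          (V ⊔ Submodule.span k {z}) ^ (n - (i : ℕ)) * (V ⊔ Submodule.span k {z}) ^ (i : ℕ) :=
        Submodule.mul_mem_mul
          ((pow_le_pow_left' (le_sup_left : V ≤ V ⊔ Submodule.span k {z}) (n - (i : ℕ)) :) (a i).2)
          (Submodule.pow_mem_pow _
            (Submodule.mem_sup_right (Submodule.mem_span_singleton_self z)) _)
      rwa [← pow_add, hi] at hmem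
    calc (n + (s + 1)).choose (s + 1) = ∑ i : Fin (n + 1), (n - i + s).choose s :=
          (sum_choose_reflect n s).symm
      _ ≤ ∑ i : Fin (n + 1), Module.finrank k (V ^ (n - (i : ℕ)) : Submodule k H) :=
          Finset.sum_le_sum fun i _ => hV _
      _ = Module.finrank k (LinearMap.range Φ) := by
          rw [LinearMap.finrank_range_of_inj hinj, Module.finrank_pi_fintype]
      _ ≤ _ := Submodule.finrank_mono hrange

variable {𝒜 : ℕ → Submodule k H}

variable (𝒜) in
/-- For every `N`, the elements of `K` of degree at most `N` lie in a space spanned by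
`(N + 1) ^ r` elements. -/
def HasGrowthAtMost (K : Subalgebra k H) (r : ℕ) : Prop :=
  ∀ N : ℕ, ∃ S : Finset H, S.card ≤ (N + 1) ^ r ∧
    ∀ i ≤ N, ∀ x ∈ K, x ∈ 𝒜 i → x ∈ Submodule.span k (S : Set H)

theorem hasGrowthAtMost_bot : HasGrowthAtMost 𝒜 (⊥ : Subalgebra k H) 0 := by
  refine fun N => ⟨{1}, by simp, fun i _ x hx _ => ?_⟩
  obtain ⟨c, rfl⟩ := Algebra.mem_bot.1 hx
  rw [Finset.coe_singleton, Algebra.algebraMap_eq_smul_one]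
  exact Submodule.smul_mem _ _ (Submodule.mem_span_singleton_self 1)

variable [GradedAlgebra 𝒜]

theorem DerivationTypeChain.hasGrowth {n s : ℕ} {K L : Subalgebra k H}
    (h : DerivationTypeChain 𝒜 n K L) (hK : HasGrowth K s) : HasGrowth L (s + n) := by
  induction h generalizing s with
  | refl => exact hK
  | @cons n K M L h _ ih =>
    obtain ⟨z, m, δ, hz⟩ := h.exists_ore
    have hzM : z ∈ M := by
      rw [← SetLike.mem_coe, ← hz.span_eq]
      exact Submodule.subset_span ⟨1, pow_one z⟩
    rw [show s + (n + 1) = s + 1 + n by ring]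
    exact ih (hK.succ h.le hzM hz.linearIndependent)

/-- If `L` contains elements of the distinct degrees in `B` that are primitive modulo `K ⊗ K` and
not in `K`, then the growth of `L` exceeds that of `K` by the cardinality of `B`. -/
theorem IsConnectedGradedHopfAlgebra.hasGrowth_add_card [CharZero k]
    (h𝒜 : IsConnectedGradedHopfAlgebra 𝒜) {K L : Subalgebra k H}
    (hK : IsGradedHopfSubalgebra 𝒜 K) (hKL : K ≤ L) {s : ℕ} (hs : HasGrowth K s) (B : Finset ℕ)
    (hB : ∀ n ∈ B, ∃ z ∈ L, z ∈ 𝒜 n ∧ z ∉ K ∧ z ∈ relPrimitive K) :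
    HasGrowth L (s + B.card) := by
  suffices h : ∃ M : Subalgebra k H, IsGradedHopfSubalgebra 𝒜 M ∧ K ≤ M ∧ M ≤ L ∧
      HasGrowth M (s + B.card) ∧
      ∀ n, (∀ b ∈ B, n < b) → ∀ x ∈ M, x ∈ 𝒜 n → x ∈ K by
    obtain ⟨M, -, -, hML, hM, -⟩ := h
    exact hM.mono hML
  -- Degrees are adjoined from the largest down. Adjoining an element changes nothing below its own
  -- degree, so the next, smaller degree still has its element outside the algebra built so far.
  induction B using Finset.induction_on_min with
  | empty => exact ⟨K, hK, le_rfl, hKL, hs, fun _ _ _ hx _ => hx⟩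
  | insert a B ha ih =>
    obtain ⟨M, hM, hKM, hML, hMs, hlow⟩ := ih fun n hn => hB n (Finset.mem_insert_of_mem hn)
    obtain ⟨z, hzL, hz, hzK, hzP⟩ := hB a (Finset.mem_insert_self a B)
    have hzM : z ∉ M := fun h => hzK (hlow a ha z h hz)
    have hzPM := relPrimitive_mono hKM hzP
    refine ⟨_root_.adjoinElement M z, h𝒜.adjoinElement hM hz hzPM,
      hKM.trans (le_adjoinElement M z), adjoinElement_le hML hzL, ?_, fun n hn x hx hxn => ?_⟩
    · rw [Finset.card_insert_of_notMem fun h => lt_irrefl a (ha a h), ← add_assoc]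
      exact hMs.succ (le_adjoinElement M z) (self_mem_adjoinElement M z)
        (h𝒜.linearIndependent_pow hM hz hzPM hzM)
    · exact hlow n (fun b hb => hn b (Finset.mem_insert_of_mem hb)) x
        (h𝒜.mem_of_mem_adjoinElement hM.isHomogeneous hz (hn a (Finset.mem_insert_self a B)) hx hxn)
        hxn

/-- Here `j` bounds the room left for growth: each extension step raises the growth exponent of the
lower algebra by one. -/
theorem IsConnectedGradedHopfAlgebra.exists_chain [CharZero k]
    (h𝒜 : IsConnectedGradedHopfAlgebra 𝒜) {L : Subalgebra k H}
    (hL : IsGradedHopfSubalgebra 𝒜 L) (j : ℕ) : ∀ (K : Subalgebra k H) (s : ℕ),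
    IsGradedHopfSubalgebra 𝒜 K → K ≤ L → HasGrowth K s → ¬ HasGrowth L (s + j) →
      ∃ n, DerivationTypeChain 𝒜 n K L := by
  induction j with
  | zero => exact fun K s _ hKL hs hLs => absurd (hs.mono hKL) hLs
  | succ j ih =>
    intro K s hK hKL hs hLs
    by_cases hLK : L ≤ K
    · obtain rfl := le_antisymm hKL hLK
      exact ⟨0, .refl K hK⟩
    let B : Set ℕ := {n | ∃ z ∈ L, z ∈ 𝒜 n ∧ z ∉ K ∧ z ∈ relPrimitive K}
    have hfin : B.Finite := by
      by_contra hinf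
      obtain ⟨B', hB', hcard⟩ := Set.Infinite.exists_subset_card_eq hinf (j + 1)
      exact hLs (hcard ▸ h𝒜.hasGrowth_add_card hK hKL hs B' fun n hn => hB' hn)
    obtain ⟨m, ⟨z, hzL, hz, hzK, hzP⟩, hmax⟩ :=
      Set.exists_max_image B id hfin (h𝒜.exists_relPrimitive hL hLK)
    have hcomm : ∀ r ∈ K, z * r - r * z ∈ K := fun r hr =>
      h𝒜.commutator_mem hK hKL hzL hz hzP (fun n hn y hyL hy hyP => by
        by_contra hyK
        exact absurd (hmax n ⟨y, hyL, hy, hyK, hyP⟩) (not_le.2 hn)) hr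
    have hstep := h𝒜.isGradedHOEOfDerivationType hK hz hzP hzK hcomm
    obtain ⟨n, hn⟩ := ih (_root_.adjoinElement K z) (s + 1) hstep.right (adjoinElement_le hKL hzL)
      (hs.succ (le_adjoinElement K z) (self_mem_adjoinElement K z)
        (h𝒜.linearIndependent_pow hK hz hzP hzK)) (by rwa [add_assoc, add_comm 1 j])
    exact ⟨n + 1, .cons hstep hn⟩

/-- The degree `i` component of `∑ c j * z ^ j` takes from `c j` its component of degree `i - j *
m`; as `m ≥ 1`, only `j ≤ N` contribute. -/
theorem HasGrowthAtMost.succ {K L : Subalgebra k H} {r : ℕ} (h : HasGrowthAtMost 𝒜 K r)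
    (hK : IsHomogeneousSubalgebra 𝒜 K) {m : ℕ} {z : H} (hz : z ∈ 𝒜 m) (hm : m ≠ 0)
    (hL : (L : Set H) ⊆ Submodule.span K (Set.range fun i : ℕ => z ^ i)) :
    HasGrowthAtMost 𝒜 L (r + 1) := by
  classical
  intro N
  obtain ⟨S, hS, hspan⟩ := h N
  refine ⟨Finset.image₂ (fun a j => a * z ^ j) S (Finset.range (N + 1)), ?_,
    fun i hi x hxL hx => ?_⟩
  · refine (Finset.card_image₂_le _ _ _).trans ?_
    rw [Finset.card_range, pow_succ]
    exact Nat.mul_le_mul_right _ hS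
  · obtain ⟨c, hc⟩ := Finsupp.mem_span_range_iff_exists_finsupp.1 (hL hxL)
    rw [← proj_same hx, ← hc, Finsupp.sum, map_sum]
    refine sum_mem fun j _ => ?_
    rw [Subalgebra.smul_def, smul_eq_mul, GradedAlgebra.proj_apply,
      DirectSum.coe_decompose_mul_of_right_mem 𝒜 i (pow_mem_degree hz j)]
    split_ifs with hji
    · have hj : j ≤ j * m := Nat.le_mul_of_pos_right j (Nat.pos_of_ne_zero hm)
      have hmem := hspan (i - j * m) (by omega) _ (hK _ (c j).2 (i - j * m))
        (proj_mem_degree _ _)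
      have hle : Submodule.span k (S : Set H) ≤ (Submodule.span k
          (Finset.image₂ (fun a j => a * z ^ j) S (Finset.range (N + 1)) : Set H)).comap
          (LinearMap.mulRight k (z ^ j)) := by
        refine Submodule.span_le.2 fun a ha => Submodule.subset_span ?_
        exact Finset.mem_coe.2 (Finset.mem_image₂_of_mem ha (Finset.mem_range.2 (by omega)))
      exact hle hmem
    · exact zero_mem _

theorem IsConnectedGradedHopfAlgebra.degree_ne_zero (h𝒜 : IsConnectedGradedHopfAlgebra 𝒜)
    {K : Subalgebra k H} {m : ℕ} {z : H} (hz : z ∈ 𝒜 m)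
    (hli : LinearIndependent K (fun i : ℕ => z ^ i)) : m ≠ 0 := by
  rintro rfl
  have hzK := h𝒜.degree_zero_le K hz
  have : Nontrivial H := Bialgebra.nontrivial (R := k)
  -- In degree zero `z` lies in `K`, giving the nontrivial relation `(-z) * 1 + 1 * z = 0`.
  have h := linearIndependent_iff'.1 hli {0, 1} (fun i => if i = 0 then -⟨z, hzK⟩ else 1)
    (by simp [Subalgebra.smul_def]) 1 (by simp)
  simp at h

theorem DerivationTypeChain.hasGrowthAtMost (h𝒜 : IsConnectedGradedHopfAlgebra 𝒜) {n r : ℕ}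
    {K L : Subalgebra k H} (h : DerivationTypeChain 𝒜 n K L) (hK : HasGrowthAtMost 𝒜 K r) :
    HasGrowthAtMost 𝒜 L (r + n) := by
  induction h generalizing r with
  | refl => exact hK
  | @cons n K M L h _ ih =>
    obtain ⟨z, m, δ, hz⟩ := h.exists_ore
    rw [show r + (n + 1) = r + 1 + n by ring]
    exact ih (hK.succ h.left.isHomogeneous hz.mem_degree
      (h𝒜.degree_ne_zero hz.mem_degree hz.linearIndependent) hz.span_eq.ge)

end Growth

/-! ### From growth bounds to Gelfand–Kirillov dimension. -/

section GelfandKirillov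

open Filter Topology

theorem tendsto_logb_natCast_const (c : ℝ) :
    Tendsto (fun n : ℕ => Real.logb n c) atTop (𝓝 0) :=
  tendsto_const_nhds.div_atTop (Real.tendsto_log_atTop.comp tendsto_natCast_atTop_atTop)

variable {k H : Type*} [Field k] [Ring H] [HopfAlgebra k H]
  {B : Type*} [Ring B] [Algebra k B] {φ : B →ₐ[k] H}

theorem finrank_map_algHom (hφ : Function.Injective φ) (W : Submodule k B) :
    Module.finrank k (W.map φ.toLinearMap) = Module.finrank k W :=
  (Submodule.equivMapOfInjective φ.toLinearMap hφ W).finrank_eq.symm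

theorem fg_iSup_pow {W : Submodule k B} (hW : W.FG) (n : ℕ) :
    (⨆ i ∈ Finset.range n, W ^ i : Submodule k B).FG :=
  Submodule.fg_biSup _ _ fun i _ => hW.pow i

/-- The binomial is at least `n ^ s / s!`, and the constant `s!` disappears under `logb n` in the
limit. -/
theorem le_limsup_logb {s : ℕ} {g : ℕ → ℕ} (hg : ∀ n, (n + s).choose s ≤ g n) :
    (s : EReal) ≤ limsup (fun n : ℕ => ((Real.logb (n : ℝ) (g n : ℝ) : ℝ) : EReal)) atTop := by
  have hlim : Tendsto (fun n : ℕ => (((s : ℝ) - Real.logb n (s.factorial : ℝ) : ℝ) : EReal))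
      atTop (𝓝 ((s : ℝ) : EReal)) := by
    have := (tendsto_logb_natCast_const (s.factorial : ℝ)).const_sub (s : ℝ)
    rw [sub_zero] at this
    exact (continuous_coe_real_ereal.tendsto _).comp this
  rw [← EReal.coe_natCast, ← hlim.limsup_eq]
  refine limsup_le_limsup ?_
  filter_upwards [eventually_ge_atTop 2] with n hn
  have hn1 : (1 : ℝ) < n := by exact_mod_cast hn
  have hn0 : (0 : ℝ) < n := by linarith
  have hfac : (0 : ℝ) < s.factorial := by exact_mod_cast s.factorial_pos
  rw [EReal.coe_le_coe_iff]
  have h1 : (s : ℝ) - Real.logb n s.factorial = Real.logb n ((n : ℝ) ^ s / s.factorial) := by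
    rw [Real.logb_div (pow_pos hn0 s).ne' hfac.ne', Real.logb_pow, Real.logb_self_eq_one hn1,
      mul_one]
  rw [h1]
  refine Real.logb_le_logb_of_le hn1 (div_pos (pow_pos hn0 s) hfac) ?_
  rw [div_le_iff₀ hfac]
  have h2 : n ^ s ≤ g n * s.factorial := by
    have h3 := Nat.pow_sub_le_descFactorial (n + s) s
    rw [Nat.descFactorial_eq_factorial_mul_choose] at h3
    calc n ^ s ≤ (n + s + 1 - s) ^ s := Nat.pow_le_pow_left (by omega) s
      _ ≤ s.factorial * (n + s).choose s := h3
      _ ≤ g n * s.factorial := by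
        rw [mul_comm]
        exact Nat.mul_le_mul_right _ (hg n)
  exact_mod_cast h2

/-- The embedding `φ` transfers growth measured inside `H` to an abstract algebra, so one statement
covers `K` as a type and `H` itself. -/
theorem HasGrowth.le_gkDim {K : Subalgebra k H} {s : ℕ} (h : HasGrowth K s)
    (hφ : Function.Injective φ) (hK : φ.range = K) : (s : EReal) ≤ gkDim k B := by
  obtain ⟨V, hVK, hfg, -, hV⟩ := h
  have hmap : (V.comap φ.toLinearMap).map φ.toLinearMap = V := by
    rw [Submodule.map_comap_eq, inf_eq_right]
    subst hK
    exact hVK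
  have hWfg : (V.comap φ.toLinearMap).FG := by
    apply Submodule.fg_of_fg_map_injective φ.toLinearMap hφ
    rwa [hmap]
  refine le_iSup₂_of_le (V.comap φ.toLinearMap) (Module.Finite.iff_fg.2 hWfg) ?_
  refine le_limsup_logb fun n => (hV n).trans ?_
  have := Module.Finite.iff_fg.2 (fg_iSup_pow hWfg (n + 1))
  calc Module.finrank k (V ^ n : Submodule k H)
      = Module.finrank k ((V.comap φ.toLinearMap) ^ n : Submodule k B) := by
        rw [← finrank_map_algHom hφ, Submodule.map_pow, hmap]
    _ ≤ _ := Submodule.finrank_mono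
        (le_iSup₂_of_le n (Finset.self_mem_range_succ n) le_rfl)

variable {𝒜 : ℕ → Submodule k H} [GradedAlgebra 𝒜]

variable (𝒜) in
/-- The elements all of whose components have degree at most `N`. -/
noncomputable def degreeLE (N : ℕ) : Submodule k H :=
  ⨅ i ∈ Set.Ioi N, LinearMap.ker (GradedAlgebra.proj 𝒜 i)

theorem mem_degreeLE {N : ℕ} {x : H} :
    x ∈ degreeLE 𝒜 N ↔ ∀ i, N < i → GradedAlgebra.proj 𝒜 i x = 0 := by
  simp only [degreeLE, Submodule.mem_iInf, Set.mem_Ioi, LinearMap.mem_ker]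

theorem degreeLE_mono {N N' : ℕ} (h : N ≤ N') : degreeLE 𝒜 N ≤ degreeLE 𝒜 N' :=
  fun _ hx => mem_degreeLE.2 fun i hi => mem_degreeLE.1 hx i (h.trans_lt hi)

theorem degree_le_degreeLE {n N : ℕ} (h : n ≤ N) : 𝒜 n ≤ degreeLE 𝒜 N :=
  fun _ hx => mem_degreeLE.2 fun _ hi => proj_ne hx (by omega)

theorem induction_degreeLE {p : H → Prop} {N : ℕ} {x : H} (hx : x ∈ degreeLE 𝒜 N)
    (hadd : ∀ a b, p a → p b → p (a + b)) (h0 : p 0)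
    (hp : ∀ n ≤ N, p (GradedAlgebra.proj 𝒜 n x)) : p x := by
  refine induction_homogeneous (𝒜 := 𝒜) x hadd h0 fun n => ?_
  by_cases hn : n ≤ N
  · exact hp n hn
  · rw [mem_degreeLE.1 hx n (by omega)]
    exact h0

theorem mul_mem_degreeLE {N M : ℕ} {x y : H} (hx : x ∈ degreeLE 𝒜 N) (hy : y ∈ degreeLE 𝒜 M) :
    x * y ∈ degreeLE 𝒜 (N + M) := by
  refine induction_degreeLE (p := fun x => x * y ∈ degreeLE 𝒜 (N + M)) hx
    (fun a b ha hb => by rw [add_mul]; exact add_mem ha hb) (by simp) fun n hn => ?_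
  refine induction_degreeLE (p := fun y => GradedAlgebra.proj 𝒜 n x * y ∈ degreeLE 𝒜 (N + M)) hy
    (fun a b ha hb => by rw [mul_add]; exact add_mem ha hb) (by simp) fun n' hn' => ?_
  exact degree_le_degreeLE (add_le_add hn hn')
    (mul_mem_degree (proj_mem_degree n x) (proj_mem_degree n' y))

theorem pow_le_degreeLE {V : Submodule k H} {N : ℕ} (hV : V ≤ degreeLE 𝒜 N) (i : ℕ) :
    V ^ i ≤ degreeLE 𝒜 (i * N) := by
  induction i with
  | zero =>
    rw [pow_zero]
    exact Submodule.one_le.2 (degree_le_degreeLE (Nat.zero_le _) SetLike.GradedOne.one_mem)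
  | succ i ih =>
    rw [pow_succ, add_mul, one_mul]
    exact Submodule.mul_le.2 fun a ha b hb => mul_mem_degreeLE (ih ha) (hV hb)

theorem exists_mem_degreeLE (x : H) : ∃ N, x ∈ degreeLE 𝒜 N := by
  obtain ⟨N, hN⟩ := exists_sum_proj (𝒜 := 𝒜) x
  refine ⟨N, ?_⟩
  rw [← hN N le_rfl]
  exact sum_mem fun i hi => degree_le_degreeLE (Finset.mem_range.1 hi).le (proj_mem_degree i x)

theorem exists_le_degreeLE {V : Submodule k H} (hV : V.FG) : ∃ N, V ≤ degreeLE 𝒜 N := by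
  refine Submodule.fg_induction (motive := fun V _ => ∃ N, V ≤ degreeLE 𝒜 N) (fun x => ?_)
    (fun V W _ _ hV hW => ?_) V hV
  · obtain ⟨N, hN⟩ := exists_mem_degreeLE (𝒜 := 𝒜) x
    exact ⟨N, by rwa [Submodule.span_singleton_le_iff_mem]⟩
  · obtain ⟨N, hN⟩ := hV
    obtain ⟨M, hM⟩ := hW
    exact ⟨N + M, sup_le (hN.trans (degreeLE_mono (Nat.le_add_right N M)))
      (hM.trans (degreeLE_mono (Nat.le_add_left M N)))⟩

theorem limsup_logb_le {r N : ℕ} {g : ℕ → ℕ} (hg : ∀ n, g n ≤ (n * N + 1) ^ r) :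
    limsup (fun n : ℕ => ((Real.logb (n : ℝ) (g n : ℝ) : ℝ) : EReal)) atTop ≤ (r : EReal) := by
  have hlim : Tendsto (fun n : ℕ => (((r : ℝ) * (1 + Real.logb n (N + 1 : ℝ)) : ℝ) : EReal))
      atTop (𝓝 ((r : ℝ) : EReal)) := by
    have := ((tendsto_logb_natCast_const (N + 1 : ℝ)).const_add 1).const_mul (r : ℝ)
    rw [add_zero, mul_one] at this
    exact (continuous_coe_real_ereal.tendsto _).comp this
  rw [← EReal.coe_natCast, ← hlim.limsup_eq]
  refine limsup_le_limsup ?_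
  filter_upwards [eventually_ge_atTop 2] with n hn
  have hn1 : (1 : ℝ) < n := by exact_mod_cast hn
  have hn0 : (0 : ℝ) < n := by linarith
  have hN : (0 : ℝ) < N + 1 := by positivity
  rw [EReal.coe_le_coe_iff]
  have h1 : (r : ℝ) * (1 + Real.logb n (N + 1 : ℝ)) = Real.logb n (((n : ℝ) * (N + 1)) ^ r) := by
    rw [Real.logb_pow, Real.logb_mul hn0.ne' hN.ne', Real.logb_self_eq_one hn1]
  rw [h1]
  -- For `g n = 0` the logarithm takes its default value `0`.
  rcases Nat.eq_zero_or_pos (g n) with h0 | h0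
  · rw [h0, Nat.cast_zero, Real.logb_zero]
    refine Real.logb_nonneg hn1 (one_le_pow₀ ?_)
    nlinarith [(Nat.cast_nonneg N : (0 : ℝ) ≤ N)]
  · refine Real.logb_le_logb_of_le hn1 (by exact_mod_cast h0) ?_
    have h2 : g n ≤ (n * (N + 1)) ^ r :=
      (hg n).trans (Nat.pow_le_pow_left (by rw [mul_add]; omega) r)
    exact_mod_cast h2

/-- A finite-dimensional `V` lives in degrees at most some `N`, so its powers up to the `n`-th live
in degrees at most `n * N`, where the growth of `K` is bounded. -/
theorem HasGrowthAtMost.gkDim_le {K : Subalgebra k H} (hK : IsHomogeneousSubalgebra 𝒜 K) {r : ℕ}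
    (h : HasGrowthAtMost 𝒜 K r) (hφ : Function.Injective φ) (hφK : φ.range = K) :
    gkDim k B ≤ (r : EReal) := by
  refine iSup₂_le fun V hV => ?_
  have hfg : V.FG := Module.Finite.iff_fg.1 hV
  obtain ⟨N, hN⟩ := exists_le_degreeLE (𝒜 := 𝒜) (hfg.map φ.toLinearMap)
  refine limsup_logb_le (N := N) fun n => ?_
  obtain ⟨S, hS, hspan⟩ := h (n * N)
  have hle : (⨆ i ∈ Finset.range (n + 1), V ^ i : Submodule k B).map φ.toLinearMap ≤
      Submodule.span k (S : Set H) := by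
    have h1 : (⨆ i ∈ Finset.range (n + 1), V ^ i : Submodule k B).map φ.toLinearMap ≤
        degreeLE 𝒜 (n * N) := by
      simp only [Submodule.map_iSup, Submodule.map_pow]
      exact iSup₂_le fun i hi => (pow_le_degreeLE hN i).trans
        (degreeLE_mono (Nat.mul_le_mul_right N (Nat.lt_succ_iff.1 (Finset.mem_range.1 hi))))
    intro x hx
    have hxK : x ∈ K := by
      obtain ⟨b, -, rfl⟩ := hx
      exact hφK ▸ ⟨b, rfl⟩
    exact induction_degreeLE (h1 hx) (fun a b => add_mem) (zero_mem _) fun i hi =>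
      hspan i hi _ (hK x hxK i) (proj_mem_degree i x)
  rw [← finrank_map_algHom hφ]
  exact (Submodule.finrank_mono hle).trans ((finrank_span_finset_le_card S).trans hS)

theorem DerivationTypeChain.gkDim_eq (h𝒜 : IsConnectedGradedHopfAlgebra 𝒜) {K : Subalgebra k H}
    (hK : IsGradedHopfSubalgebra 𝒜 K) {n : ℕ} (h : DerivationTypeChain 𝒜 n ⊥ K)
    (hφ : Function.Injective φ) (hφK : φ.range = K) : gkDim k B = (n : EReal) := by
  have h1 := h.hasGrowth (hasGrowth_zero ⊥)
  have h2 := h.hasGrowthAtMost h𝒜 hasGrowthAtMost_bot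
  rw [zero_add] at h1 h2
  exact le_antisymm (h2.gkDim_le hK.isHomogeneous hφ hφK) (h1.le_gkDim hφ hφK)

theorem exists_not_hasGrowth {K : Subalgebra k H} {e : ℝ} (he : gkDim k B = (e : EReal))
    (hφ : Function.Injective φ) (hφK : φ.range = K) : ∃ j, ¬ HasGrowth K (0 + j) := by
  obtain ⟨j, hj⟩ := exists_nat_gt e
  refine ⟨j, fun h => ?_⟩
  have := h.le_gkDim hφ hφK
  rw [he, zero_add, ← EReal.coe_natCast, EReal.coe_le_coe_iff] at this
  linarith

end GelfandKirillov

theorem theoremB {k H : Type*} [Field k] [CharZero k] [Ring H] [HopfAlgebra k H]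
    (𝒜 : ℕ → Submodule k H) [GradedAlgebra 𝒜] (h𝒜 : IsConnectedGradedHopfAlgebra 𝒜)
    (K : Subalgebra k H) (hK : IsGradedHopfSubalgebra 𝒜 K)
    (d e : ℝ) (hd : gkDim k H = (d : EReal)) (he : gkDim k K = (e : EReal)) :
    ∃ n : ℕ, (n : ℝ) = d - e ∧ IsGradedIHOEOfDerivationType 𝒜 n K := by
  have hKinj : Function.Injective K.val := Subtype.val_injective
  have hKrange : K.val.range = K := Subalgebra.range_val K
  have hHinj : Function.Injective (AlgHom.id k H) := Function.injective_id
  have hHrange : (AlgHom.id k H).range = ⊤ := Algebra.range_id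
  obtain ⟨i, hi⟩ := exists_not_hasGrowth he hKinj hKrange
  obtain ⟨j, hj⟩ := exists_not_hasGrowth hd hHinj hHrange
  obtain ⟨r, hr⟩ := h𝒜.exists_chain hK i ⊥ 0 h𝒜.bot bot_le (hasGrowth_zero ⊥) hi
  obtain ⟨n, hn⟩ := h𝒜.exists_chain h𝒜.top j K 0 hK le_top (hasGrowth_zero K) hj
  have h1 := hr.gkDim_eq h𝒜 hK hKinj hKrange
  -- The concatenated chain from `k` through `K` to `H` has length `n + r`, while `r` is already
  -- `e`.
  have h2 := (hr.trans hn).gkDim_eq h𝒜 h𝒜.top hHinj hHrange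
  rw [he, ← EReal.coe_natCast, EReal.coe_eq_coe_iff] at h1
  rw [hd, ← EReal.coe_natCast, EReal.coe_eq_coe_iff, Nat.cast_add] at h2
  exact ⟨n, by rw [h1, h2, add_sub_cancel_right], hn.isGradedIHOEOfDerivationType⟩
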